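/- \textbf{Setting.} Let $S$ and $A$ be Polish spaces with their Borel $\sigma$-fields, $P(ds'\mid s,a)$ a stochastic kernel from $S\times A$ to $S$, $c:S\times A\to\mathbb R$ measurable with $|c|\le 1$, $\gamma\in[0,1)$, $\tau>0$, $\mu$ a probability measure on $A$ and $\rho$ a probability measure on $S$. Let $B_b(S\times A)$ be the space of bounded measurable functions with the supremum norm $|\cdot|_{B_b}$, and let $\Pi_\mu$ be the class of policies $\pi(da\mid s)=\frac{\exp(f(s,a))\,\mu(da)}{\int_A\exp(f(s,a'))\,\mu(da')}$ with $f\in B_b(S\times A)$; write $\frac{d\pi}{d\mu}(a\mid s)$ for this density. For $\pi\in\Pi_\mu$ put \[ V_\tau^\pi(\rho)=\mathbb E\Big[\sum_{n\ge0}\gamma^n\big(c(s_n,a_n)+\tau\log\tfrac{d\pi}{d\mu}(a_n\mid s_n)\big)\Big],\qquad s_0\sim\rho,\ a_n\sim\pi(\cdot\mid s_n),\ s_{n+1}\sim P(\cdot\mid s_n,a_n), \] $V_\tau^\pi(s)=V_\tau^\pi(\delta_s)$ and $Q_\tau^\pi(s,a)=c(s,a)+\gamma\int_S V_\tau^\pi(s')P(ds'\mid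 s,a)$. Let $V_\tau^*(s)=\inf_{\pi\in\Pi_\mu}V_\tau^\pi(s)$ and $Q_\tau^*(s,a)=c(s,a)+\gamma\int_S V_\tau^*(s')P(ds'\mid s,a)$. Let $P_\pi(ds'\mid s)=\int_A P(ds'\mid s,a)\pi(da\mid s)$, $d^\pi(ds'\mid s)=(1-\gamma)\sum_{n\ge0}\gamma^nP_\pi^n(ds'\mid s)$ and $d^\pi_\rho(ds)=\int_S d^\pi(ds\mid s')\rho(ds')$. Let $g:S\times A\to\mathbb R^p$ be measurable with $\|g(s,a)\|_2\le1$ for all $(s,a)$, and for $\theta\in\mathbb R^p$ let $\pi_\theta\in\Pi_\mu$ be the policy with exponent $f(s,a)=\langle\theta,g(s,a)\rangle$. Let $G^{\pi_\theta}(s)=\int_A \nabla_\theta\log\tfrac{d\pi_\theta}{d\mu}(a\mid s)\,\big(\nabla_\theta\log\tfrac{d\pi_\theta}{d\mu}(a\mid s)\big)^{\top}\pi_\theta(da\mid s)$ be the Fisher information matrix, and let $\lambda_{\min}$ denote the smallest eigenvalue. Assume $Q_\tau^\pi$-realizability: for every $\pi\in\Pi_\mu$ there is a unique $\boldsymbol\theta(\pi)\in\mathbb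 R^p$ with $\langle\boldsymbol\theta(\pi),g(s,a)\rangle=-\frac1\tau Q_\tau^\pi(s,a)$ for all $s\in S$, $a\in A$. \textbf{Theorem (Non-uniform P\L{} inequality).} There is a unique $\theta^*\in\mathbb R^p$ with $\langle\theta^*,g(s,a)\rangle=-\frac1\tau Q^*_\tau(s,a)$ for all $(s,a)$, and $V_\tau^{\pi_{\theta^*}}(s)=V_\tau^*(s)$ for all $s$. Let $R\ge\big|\log\frac{d\pi_{\theta^*}}{d\mu}\big|_{B_b}$ and let $\theta\in\mathbb R^p$ satisfy $\big|\log\frac{d\pi_\theta}{d\mu}\big|_{B_b}\le R$. Then $\vartheta\mapsto V_\tau^{\pi_\vartheta}(\rho)$ is differentiable at $\theta$, and there is a real $C_R(\theta)>0$ with \[ 0\le V_\tau^{\pi_\theta}(\rho)-V_\tau^{\pi_{\theta^*}}(\rho)\le C_R(\theta)\,\big\|\nabla_\theta V_\tau^{\pi_\theta}(\rho)\big\|_2^2 , \] where \[ C_R(\theta)=\frac{1}{2(1-\gamma)\tau\exp\!\Big(-\max\big(\tfrac{2}{(1-\gamma)\tau}(1+\gamma\tau R),\,R\big)\Big)}\;\Big|\frac{d\,d_\rho^{\pi_{\theta^*}}}{d\rho}\Big|_\infty^2\;\lambda^\theta,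 \qquad \lambda^\theta=\Big[\int_S\lambda_{\min}\big(G^{\pi_\theta}(s)\big)\,d_\rho^{\pi_{\theta^*}}(ds)\Big]^{-2}, \] whenever the right-hand side of this formula is finite. Here $|\cdot|_\infty$ is the $\rho$-essential supremum of the density (that is, the supremum of its smallest version), which is $\infty$ if $d_\rho^{\pi_{\theta^*}}$ is not absolutely continuous with respect to $\rho$, and $0^{-2}=\infty$; if the formula gives $\infty$, the inequality still holds with some real $C_R(\theta)>0$. Moreover, if the features lie in the probability simplex, i.e. $\sum_{i=1}^pg_i(s,a)=1$ and $g_i(s,a)\ge0$ for all $s,a,i$, then the same statement holds with $\lambda^\theta$ replaced by \[ \lambda^\theta=\Big[\int_S\lambda_{\min}\Big(\int_Ag(s,a)g(s,a)^\top\pi_\theta(da\mid s)\Big)\,d_\rho^{\pi_\theta}(ds)\Big]^{-2}. \] -/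

import Mathlib

open MeasureTheory ProbabilityTheory
open scoped ENNReal RealInnerProductSpace

noncomputable section

/-- An entropy-regularized discounted Markov decision model `(S, A, P, c, γ, τ, μ)`: transition
kernel `P`, bounded measurable cost `c` normalized to `|c| ≤ 1`, discount factor `γ`,
regularization strength `τ` and reference probability measure `μ` on the actions. -/
structure EntropyMDP (S A : Type*) [MeasurableSpace S] [MeasurableSpace A] where
  P : Kernel (S × A) S
  isMarkov : IsMarkovKernel P
  c : S → A → ℝ
  measurable_c : Measurable (Function.uncurry c)
  abs_c_le : ∀ s a, |c s a| ≤ 1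
  γ : ℝ
  γ_nonneg : 0 ≤ γ
  γ_lt_one : γ < 1
  τ : ℝ
  τ_pos : 0 < τ
  μ : Measure A
  isProb : IsProbabilityMeasure μ

/-- The space `B_b(S × A)` of bounded measurable functions. -/
structure BddFun (S A : Type*) [MeasurableSpace S] [MeasurableSpace A] where
  toFun : S → A → ℝ
  measurable' : Measurable (Function.uncurry toFun)
  bounded' : ∃ C : ℝ, ∀ s a, |toFun s a| ≤ C

instance (S A : Type*) [MeasurableSpace S] [MeasurableSpace A] :
    CoeFun (BddFun S A) (fun _ => S → A → ℝ) := ⟨BddFun.toFun⟩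

/-- Measurable features `g : S × A → ℝᵖ` with `‖g(s,a)‖₂ ≤ 1`. -/
structure Features (S A : Type*) [MeasurableSpace S] [MeasurableSpace A] (p : ℕ) where
  toFun : S → A → EuclideanSpace ℝ (Fin p)
  measurable' : Measurable (Function.uncurry toFun)
  norm_le_one : ∀ s a, ‖toFun s a‖ ≤ 1

instance (S A : Type*) [MeasurableSpace S] [MeasurableSpace A] (p : ℕ) :
    CoeFun (Features S A p) (fun _ => S → A → EuclideanSpace ℝ (Fin p)) := ⟨Features.toFun⟩

namespace Features

variable {S A : Type*} [MeasurableSpace S] [MeasurableSpace A] {p : ℕ}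

/-- The log-linear exponent `(s, a) ↦ ⟨θ, g(s,a)⟩`. -/
def logit (g : Features S A p) (θ : EuclideanSpace ℝ (Fin p)) : BddFun S A where
  toFun s a := ⟪θ, g s a⟫
  measurable' := by
    have h := g.measurable'
    exact Measurable.inner (measurable_const (a := θ)) h
  bounded' := ⟨‖θ‖, fun s a => (abs_real_inner_le_norm _ _).trans
    (mul_le_of_le_one_right (norm_nonneg _) (g.norm_le_one s a))⟩

/-- All feature vectors lie in the probability simplex. -/
def IsSimplex (g : Features S A p) : Prop :=
  ∀ s a, ∑ i, g s a i = 1 ∧ ∀ i, 0 ≤ g s a i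

end Features

/-- Smallest eigenvalue of a real symmetric matrix. -/
def lambdaMin {p : ℕ} (M : Matrix (Fin p) (Fin p) ℝ) : ℝ := sInf (spectrum ℝ M)

open Classical in
/-- The supremum norm `|dν/dρ|` of the density of `ν` with respect to `ρ`, taken for the smallest
version of the density; it is `∞` if `ν` has no density. -/
def densitySup {S : Type*} [MeasurableSpace S] (ν ρ : Measure S) : ℝ≥0∞ :=
  if ν ≪ ρ then essSup (ν.rnDeriv ρ) ρ else ⊤

namespace EntropyMDP

variable {S A : Type*} [MeasurableSpace S] [MeasurableSpace A] {p : ℕ}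

instance (M : EntropyMDP S A) : IsMarkovKernel M.P := M.isMarkov
instance (M : EntropyMDP S A) : IsProbabilityMeasure M.μ := M.isProb

/-- The density `dπ/dμ(a|s) = exp f(s,a) / ∫ exp f(s,a') μ(da')` of the softmax policy `π` with
exponent `f`. These policies, for `f ∈ B_b(S × A)`, form the class `Π_μ`. -/
def density (M : EntropyMDP S A) (f : BddFun S A) (s : S) (a : A) : ℝ :=
  Real.exp (f s a) / ∫ a', Real.exp (f s a') ∂M.μ

/-- The log-density `log dπ/dμ(a|s)` of the softmax policy with exponent `f`. -/
def logDensity (M : EntropyMDP S A) (f : BddFun S A) (s : S) (a : A) : ℝ :=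
  Real.log (M.density f s a)

/-- The softmax policy with exponent `f`, as a kernel from states to actions. -/
def policy (M : EntropyMDP S A) (f : BddFun S A) : Kernel S A :=
  Kernel.withDensity (Kernel.const S M.μ) (fun s a => ENNReal.ofReal (M.density f s a))

lemma measurable_density (M : EntropyMDP S A) (f : BddFun S A) :
    Measurable (Function.uncurry (M.density f)) := by
  have h : Measurable (fun x : S × A => Real.exp (f x.1 x.2)) := f.measurable'.exp
  have h2 : Measurable (fun s : S => ∫ a', Real.exp (f s a') ∂M.μ) :=
    (h.stronglyMeasurable.integral_prod_right (ν := M.μ)).measurable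
  exact h.div (h2.comp measurable_fst)

lemma policy_apply (M : EntropyMDP S A) (f : BddFun S A) (s : S) :
    M.policy f s = M.μ.withDensity (fun a => ENNReal.ofReal (M.density f s a)) := by
  have := Kernel.withDensity_apply (Kernel.const S M.μ)
    (f := fun s a => ENNReal.ofReal (M.density f s a)) (M.measurable_density f).ennreal_ofReal s
  simpa [policy] using this

instance (M : EntropyMDP S A) (f : BddFun S A) : IsMarkovKernel (M.policy f) := by
  refine ⟨fun s => ⟨?_⟩⟩
  obtain ⟨C, hC⟩ := f.bounded'
  have hm : Measurable (fun a => Real.exp (f s a)) :=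
    (f.measurable'.comp (measurable_const.prodMk measurable_id)).exp
  have hint : Integrable (fun a => Real.exp (f s a)) M.μ := by
    refine Integrable.of_bound hm.aestronglyMeasurable (Real.exp C) (Filter.Eventually.of_forall ?_)
    intro a
    rw [Real.norm_eq_abs, Real.abs_exp]
    exact Real.exp_le_exp.2 ((le_abs_self _).trans (hC s a))
  have hpos : 0 < ∫ a, Real.exp (f s a) ∂M.μ := integral_exp_pos hint
  rw [policy_apply, withDensity_apply _ MeasurableSet.univ, Measure.restrict_univ]
  unfold density
  rw [← ofReal_integral_eq_lintegral_ofReal (hint.div_const _)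
      (Filter.Eventually.of_forall fun a => div_nonneg (Real.exp_pos _).le hpos.le)]
  rw [integral_div, div_self hpos.ne', ENNReal.ofReal_one]

/-- One step of the state-action chain under the softmax policy `π` with exponent `f`:
`s' ∼ P(·|s,a)`, `a' ∼ π(·|s')`. -/
def step (M : EntropyMDP S A) (f : BddFun S A) : Kernel (S × A) (S × A) :=
  M.P ⊗ₖ Kernel.prodMkLeft (S × A) (M.policy f)

instance (M : EntropyMDP S A) (f : BddFun S A) : IsMarkovKernel (M.step f) := by
  unfold step; infer_instance

/-- The law of the trajectory `(s₀, a₀), (s₁, a₁), …` with `s₀ ∼ ρ`, `aₙ ∼ π(·|sₙ)`,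
`sₙ₊₁ ∼ P(·|sₙ,aₙ)`, where `π` is the softmax policy with exponent `f`. -/
def trajLaw (M : EntropyMDP S A) (f : BddFun S A) (ρ : Measure S) : Measure (ℕ → S × A) :=
  Kernel.trajMeasure (X := fun _ => S × A) (ρ ⊗ₘ M.policy f)
    (fun n => (M.step f).comap (fun h => h ⟨n, Finset.mem_Iic.2 le_rfl⟩) (measurable_pi_apply _))

/-- The regularized value `V_τ^π(ρ) = E[∑ₙ γⁿ (c(sₙ,aₙ) + τ log dπ/dμ(aₙ|sₙ))]`. -/
def value (M : EntropyMDP S A) (f : BddFun S A) (ρ : Measure S) : ℝ :=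
  ∫ ω, ∑' n : ℕ, M.γ ^ n * (M.c (ω n).1 (ω n).2 + M.τ * M.logDensity f (ω n).1 (ω n).2)
    ∂(M.trajLaw f ρ)

/-- `V_τ^π(s)`: the value with initial state `s`. -/
def valueAt (M : EntropyMDP S A) (f : BddFun S A) (s : S) : ℝ := M.value f (Measure.dirac s)

/-- `Q_τ^π(s,a) = c(s,a) + γ ∫ V_τ^π(s') P(ds'|s,a)`. -/
def qValue (M : EntropyMDP S A) (f : BddFun S A) (s : S) (a : A) : ℝ :=
  M.c s a + M.γ * ∫ s', M.valueAt f s' ∂(M.P (s, a))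

/-- The optimal value `V_τ^*(s)`, the infimum of `V_τ^π(s)` over `π ∈ Π_μ`. -/
def optValue (M : EntropyMDP S A) (s : S) : ℝ := ⨅ f : BddFun S A, M.valueAt f s

/-- `Q_τ^*(s,a) = c(s,a) + γ ∫ V_τ^*(s') P(ds'|s,a)`. -/
def optQ (M : EntropyMDP S A) (s : S) (a : A) : ℝ :=
  M.c s a + M.γ * ∫ s', M.optValue s' ∂(M.P (s, a))

/-- The state transition kernel `P_π(ds'|s) = ∫ P(ds'|s,a) π(da|s)`. -/
def stateKernel (M : EntropyMDP S A) (f : BddFun S A) : Kernel S S :=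
  M.P ∘ₖ (Kernel.id ×ₖ M.policy f)

/-- The occupancy kernel `d^π(ds'|s) = (1-γ) ∑ₙ γⁿ P_πⁿ(ds'|s)`. -/
def occKernel (M : EntropyMDP S A) (f : BddFun S A) : Kernel S S where
  toFun s := Measure.sum fun n : ℕ =>
    ENNReal.ofReal ((1 - M.γ) * M.γ ^ n) • ((M.stateKernel f) ^ n) s
  measurable' := by
    refine Measure.measurable_of_measurable_coe _ fun t ht => ?_
    simp_rw [Measure.sum_apply _ ht, Measure.smul_apply, smul_eq_mul]
    exact Measurable.tsum fun n =>
      (Kernel.measurable_coe ((M.stateKernel f) ^ n) ht).const_mul _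

/-- The occupancy measure `d^π_ρ(ds) = ∫ d^π(ds|s') ρ(ds')`. -/
def occ (M : EntropyMDP S A) (f : BddFun S A) (ρ : Measure S) : Measure S :=
  M.occKernel f ∘ₘ ρ

/-- `Q^π_τ`-realizability. -/
def Realizable (M : EntropyMDP S A) (g : Features S A p) : Prop :=
  ∀ f : BddFun S A, ∃! θ : EuclideanSpace ℝ (Fin p),
    ∀ s a, ⟪θ, g s a⟫ = -(1 / M.τ) * M.qValue f s a

/-- `θ*` is an optimal parameter: `⟨θ*, g⟩ = -Q_τ^* / τ`. -/
def IsOptParam (M : EntropyMDP S A) (g : Features S A p) (θ : EuclideanSpace ℝ (Fin p)) : Prop :=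
  ∀ s a, ⟪θ, g s a⟫ = -(1 / M.τ) * M.optQ s a

/-- `|log dπ/dμ|_{B_b(S × A)} ≤ R` for the softmax policy `π` with exponent `f`. -/
def LogDensityBound (M : EntropyMDP S A) (f : BddFun S A) (R : ℝ) : Prop :=
  ∀ s a, |M.logDensity f s a| ≤ R

/-- The score `∇_θ log dπ_θ/dμ(a|s)`. -/
def score (M : EntropyMDP S A) (g : Features S A p) (θ : EuclideanSpace ℝ (Fin p))
    (s : S) (a : A) : EuclideanSpace ℝ (Fin p) :=
  gradient (fun ϑ => M.logDensity (g.logit ϑ) s a) θ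

/-- The Fisher information matrix `G^{π_θ}(s)`. -/
def fisher (M : EntropyMDP S A) (g : Features S A p) (θ : EuclideanSpace ℝ (Fin p)) (s : S) :
    Matrix (Fin p) (Fin p) ℝ :=
  Matrix.of fun i j => ∫ a, M.score g θ s a i * M.score g θ s a j ∂(M.policy (g.logit θ) s)

/-- The uncentered feature covariance `∫ g(s,a) g(s,a)ᵀ π_θ(da|s)`. -/
def featureCov (M : EntropyMDP S A) (g : Features S A p) (θ : EuclideanSpace ℝ (Fin p)) (s : S) :
    Matrix (Fin p) (Fin p) ℝ :=
  Matrix.of fun i j => ∫ a, g s a i * g s a j ∂(M.policy (g.logit θ) s)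

/-- `[∫ λ_min(G^{π_θ}(s)) d_ρ^{π_θ*}(ds)]⁻²`, equal to `∞` if the integral vanishes. -/
def lamFisher (M : EntropyMDP S A) (g : Features S A p) (ρ : Measure S)
    (θs θ : EuclideanSpace ℝ (Fin p)) : ℝ≥0∞ :=
  ((ENNReal.ofReal (∫ s, lambdaMin (M.fisher g θ s) ∂(M.occ (g.logit θs) ρ))) ^ 2)⁻¹

/-- `[∫ λ_min(∫ g(s,a) g(s,a)ᵀ π_θ(da|s)) d_ρ^{π_θ}(ds)]⁻²`, equal to `∞` if the integral
vanishes. -/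
def lamCov (M : EntropyMDP S A) (g : Features S A p) (ρ : Measure S)
    (θ : EuclideanSpace ℝ (Fin p)) : ℝ≥0∞ :=
  ((ENNReal.ofReal (∫ s, lambdaMin (M.featureCov g θ s) ∂(M.occ (g.logit θ) ρ))) ^ 2)⁻¹

/-- The constant `C_R(θ)`, with `lam` in the place of `λ^θ`. -/
def plConst (M : EntropyMDP S A) (g : Features S A p) (ρ : Measure S) (R : ℝ)
    (θs : EuclideanSpace ℝ (Fin p)) (lam : ℝ≥0∞) : ℝ≥0∞ :=
  ENNReal.ofReal (1 / (2 * (1 - M.γ) * M.τ *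
      Real.exp (-max (2 / ((1 - M.γ) * M.τ) * (1 + M.γ * M.τ * R)) R))) *
    densitySup (M.occ (g.logit θs) ρ) ρ ^ 2 * lam

end EntropyMDP

end

/-!
The argument rests on the Bellman operators `T_π` (`bellman`) and `T` (`softBellman`). Trajectory
expectations are turned into occupancy averages (`value_eq_integral_occ`), and the flow equation of
the occupancy measure gives, for every bounded `v`, the performance difference identity
`V^π(ρ) - ∫ v dρ = (1-γ)⁻¹ ∫ (T_π v - v) d(d^π_ρ)` (`value_sub_integral`). The Gibbs variational
principle with its deficit (`bellman_eq_softBellman_add`) says that `T_π v - T v` is `τ` times the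
relative entropy of `π` with respect to the greedy policy `∝ exp(-(c + γPv)/τ) μ`, written below
as a gap `log ∫ eʷ dπ - ∫ w dπ` in Jensen's inequality.

*Optimal parameter.* `T` has a bounded fixed point, obtained by value iteration; by the two facts
above it lies below every `V^π` and is the value of its own greedy policy. Hence it is `V*`, and
`Q*` is the state-action value of a policy in the class, to which realizability applies.

*Gradient.* By realizability the exponent `w = -Q^π/τ - ⟨θ, g⟩` that makes `π = π_θ` greedy has the
form `⟨δ, g⟩`. The performance difference identity with the occupancy measure of `π_θ` and
uniform second-order estimates (`exists_abs_value_sub_le`) show that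
`⟨∇V, h⟩ = -τ/(1-γ) ∫ Cov_{π_θ}(⟨h, g⟩, ⟨δ, g⟩) d(d^{π_θ}_ρ)`.

*Inequality.* With `v = V^{π_θ}` and the occupancy measure of `π*`, the performance difference
identity bounds the suboptimality by `τ/(1-γ)` times an average of Jensen gaps of `⟨δ, g⟩`, and
each of these is at most `‖δ‖²/2` by Hoeffding's lemma. Pairing the gradient with `δ` gives
`‖∇V‖ ‖δ‖ ≥ τ/(1-γ) ∫ Var_{π_θ}⟨δ, g⟩ d(d^{π_θ}_ρ)`, and since
`d^{π*}_ρ ≤ D ρ ≤ D/(1-γ) d^{π_θ}_ρ` this is at least `(τ/D) ‖δ‖² ∫ λ_min(G) d(d^{π*}_ρ)`.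
Eliminating `‖δ‖` yields the claim, even without the exponential factor, which is at least `1`.
For simplex features `δ` is first projected to the orthogonal complement of `1`, where the variance
is bounded below by the uncentred covariance (`lambdaMin_featureCov_mul_le`).

If the constant is infinite, it suffices that a critical point is optimal
(`value_le_of_gradient_eq_zero`): there `⟨δ, g⟩` has zero variance in almost every state visited by
`π_θ`, hence by `π*`, because all policies of the class are mutually absolutely continuous; so the
Jensen gaps vanish.
-/

/-! ### Bounded measurable functions -/

/-- `u` is a bounded measurable real function; on a finite measure space such functions are
integrable, and they are stable under all the operations used below. -/
def IsBddMeas {X : Type*} [MeasurableSpace X] (u : X → ℝ) : Prop :=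
  Measurable u ∧ ∃ C : ℝ, ∀ x, |u x| ≤ C

namespace IsBddMeas

variable {X Y : Type*} [MeasurableSpace X] [MeasurableSpace Y] {u v : X → ℝ}

lemma measurable (hu : IsBddMeas u) : Measurable u := hu.1

lemma const (c : ℝ) : IsBddMeas (fun _ : X => c) := ⟨measurable_const, |c|, fun _ => le_rfl⟩

lemma add (hu : IsBddMeas u) (hv : IsBddMeas v) : IsBddMeas (fun x => u x + v x) := by
  obtain ⟨hu, C, hC⟩ := hu
  obtain ⟨hv, D, hD⟩ := hv
  exact ⟨hu.add hv, C + D, fun x => (abs_add_le _ _).trans (add_le_add (hC x) (hD x))⟩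

lemma mul (hu : IsBddMeas u) (hv : IsBddMeas v) : IsBddMeas (fun x => u x * v x) := by
  obtain ⟨hu, C, hC⟩ := hu
  obtain ⟨hv, D, hD⟩ := hv
  refine ⟨hu.mul hv, C * D, fun x => ?_⟩
  rw [abs_mul]
  exact mul_le_mul (hC x) (hD x) (abs_nonneg _) ((abs_nonneg _).trans (hC x))

lemma const_mul (hu : IsBddMeas u) (c : ℝ) : IsBddMeas (fun x => c * u x) := (const c).mul hu

lemma neg (hu : IsBddMeas u) : IsBddMeas (fun x => -u x) := by
  simpa using hu.const_mul (-1)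

lemma sub (hu : IsBddMeas u) (hv : IsBddMeas v) : IsBddMeas (fun x => u x - v x) := by
  simpa [sub_eq_add_neg] using hu.add hv.neg

lemma comp (hu : IsBddMeas u) {φ : Y → X} (hφ : Measurable φ) : IsBddMeas (fun y => u (φ y)) :=
  ⟨hu.1.comp hφ, hu.2.imp fun _ h y => h (φ y)⟩

lemma exp (hu : IsBddMeas u) : IsBddMeas (fun x => Real.exp (u x)) := by
  obtain ⟨hu, C, hC⟩ := hu
  refine ⟨hu.exp, Real.exp C, fun x => ?_⟩
  rw [Real.abs_exp]
  exact Real.exp_le_exp.2 ((le_abs_self _).trans (hC x))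

lemma memLp (hu : IsBddMeas u) (ν : Measure X) [IsFiniteMeasure ν] (q : ℝ≥0∞) :
    MemLp u q ν := by
  obtain ⟨hu, C, hC⟩ := hu
  exact MemLp.of_bound hu.aestronglyMeasurable C (Filter.Eventually.of_forall hC)

lemma integrable (hu : IsBddMeas u) (ν : Measure X) [IsFiniteMeasure ν] : Integrable u ν :=
  memLp_one_iff_integrable.1 (hu.memLp ν 1)

end IsBddMeas

lemma abs_integral_le_of_abs_le {X : Type*} [MeasurableSpace X] {u : X → ℝ} {C : ℝ}
    (ν : Measure X) [IsProbabilityMeasure ν] (h : ∀ x, |u x| ≤ C) : |∫ x, u x ∂ν| ≤ C := by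
  have := norm_integral_le_of_norm_le_const (μ := ν) (f := u) (C := C)
    (Filter.Eventually.of_forall h)
  simpa using this

lemma integral_le_of_le {X : Type*} [MeasurableSpace X] {u : X → ℝ} {C : ℝ} (hu : IsBddMeas u)
    (ν : Measure X) [IsProbabilityMeasure ν] (h : ∀ x, u x ≤ C) : ∫ x, u x ∂ν ≤ C := by
  have := integral_mono (hu.integrable ν) (integrable_const C) h
  simpa using this

lemma IsBddMeas.integral_kernel_prod {X Y : Type*} [MeasurableSpace X] [MeasurableSpace Y]
    {u : X × Y → ℝ} (hu : IsBddMeas u) (κ : Kernel X Y) [IsMarkovKernel κ] :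
    IsBddMeas (fun x => ∫ y, u (x, y) ∂κ x) := by
  obtain ⟨hu, C, hC⟩ := hu
  exact ⟨(hu.stronglyMeasurable.integral_kernel_prod_right' (κ := κ)).measurable, C,
    fun x => abs_integral_le_of_abs_le _ fun y => hC _⟩

lemma IsBddMeas.integral_kernel {X Y : Type*} [MeasurableSpace X] [MeasurableSpace Y]
    {u : Y → ℝ} (hu : IsBddMeas u) (κ : Kernel X Y) [IsMarkovKernel κ] :
    IsBddMeas (fun x => ∫ y, u y ∂κ x) :=
  (hu.comp measurable_snd).integral_kernel_prod κ

lemma IsBddMeas.integral_bind {X Y : Type*} [MeasurableSpace X] [MeasurableSpace Y]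
    {u : Y → ℝ} (hu : IsBddMeas u) (κ : Kernel X Y) [IsMarkovKernel κ] (ν : Measure X)
    [IsProbabilityMeasure ν] : ∫ y, u y ∂(κ ∘ₘ ν) = ∫ x, ∫ y, u y ∂κ x ∂ν := by
  rw [Measure.comp_eq_comp_const_apply, Kernel.integral_comp, Kernel.const_apply]
  rw [← Measure.comp_eq_comp_const_apply]
  exact hu.integrable _

/-! ### The gap in Jensen's inequality for the exponential -/

/-- The gap `log ∫ eʷ dν - ∫ w dν` in Jensen's inequality. It is the relative entropy of `ν` with
respect to the tilted measure `∝ eʷ ν`. -/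
noncomputable def jensenGap {X : Type*} [MeasurableSpace X] (ν : Measure X) (w : X → ℝ) : ℝ :=
  Real.log (∫ x, Real.exp (w x) ∂ν) - ∫ x, w x ∂ν

lemma jensenGap_congr {X : Type*} [MeasurableSpace X] {ν : Measure X} {w w' : X → ℝ}
    (h : w =ᵐ[ν] w') : jensenGap ν w = jensenGap ν w' := by
  have he : ∫ x, Real.exp (w x) ∂ν = ∫ x, Real.exp (w' x) ∂ν :=
    integral_congr_ae (h.fun_comp Real.exp)
  rw [jensenGap, jensenGap, he, integral_congr_ae h]

section JensenGap

variable {X : Type*} [MeasurableSpace X] (ν : Measure X) [IsProbabilityMeasure ν] {w : X → ℝ}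

lemma integral_exp_pos_of_isBddMeas (hw : IsBddMeas w) : 0 < ∫ x, Real.exp (w x) ∂ν :=
  integral_exp_pos (hw.exp.integrable ν)

lemma jensenGap_nonneg (hw : IsBddMeas w) : 0 ≤ jensenGap ν w := by
  have h := convexOn_exp.map_integral_le (μ := ν) (f := w) Real.continuous_exp.continuousOn
    isClosed_univ (by simp) (hw.integrable ν) (hw.exp.integrable ν)
  have := (Real.le_log_iff_exp_le (integral_exp_pos_of_isBddMeas ν hw)).2 h
  unfold jensenGap
  linarith

lemma jensenGap_add_const (hw : IsBddMeas w) (c : ℝ) :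
    jensenGap ν (fun x => w x + c) = jensenGap ν w := by
  unfold jensenGap
  simp_rw [Real.exp_add]
  rw [integral_mul_const, integral_add (hw.integrable ν) (integrable_const c),
    Real.log_mul (integral_exp_pos_of_isBddMeas ν hw).ne' (Real.exp_pos c).ne', Real.log_exp]
  simp

/-- Hoeffding's lemma. -/
lemma jensenGap_le_half_sq (hw : IsBddMeas w) {b : ℝ} (hb : ∀ x, |w x| ≤ b) :
    jensenGap ν w ≤ b ^ 2 / 2 := by
  have hb0 : 0 ≤ b := by
    obtain ⟨x⟩ := nonempty_of_isProbabilityMeasure ν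
    exact (abs_nonneg _).trans (hb x)
  have h := (hasSubgaussianMGF_of_mem_Icc (μ := ν) (X := w) (a := -b) (b := b)
    hw.measurable.aemeasurable (Filter.Eventually.of_forall fun x => abs_le.1 (hb x))).mgf_le 1
  have hc : (((‖b - -b‖₊ / 2) ^ 2 : NNReal) : ℝ) = b ^ 2 := by
    push_cast
    rw [Real.norm_eq_abs, abs_of_nonneg (by linarith)]
    ring
  rw [hc, mgf] at h
  have hgap : jensenGap ν w = jensenGap ν (fun x => w x + -∫ x, w x ∂ν) :=
    (jensenGap_add_const ν hw _).symm
  have hw' : IsBddMeas (fun x => w x + -∫ x, w x ∂ν) := hw.add (IsBddMeas.const _)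
  have hzero : ∫ x, (w x + -∫ x, w x ∂ν) ∂ν = 0 := by
    rw [integral_add (hw.integrable ν) (integrable_const _)]
    simp
  rw [hgap, jensenGap, hzero, sub_zero,
    Real.log_le_iff_le_exp (integral_exp_pos_of_isBddMeas ν hw')]
  simpa [sub_eq_add_neg] using h

lemma jensenGap_const (c : ℝ) : jensenGap ν (fun _ => c) = 0 := by
  simp [jensenGap]

end JensenGap

/-! ### First-order expansion of tilted means -/

lemma integral_tilted_eq_div {X : Type*} [MeasurableSpace X] (ν : Measure X) (x y : X → ℝ) :
    ∫ a, y a ∂(ν.tilted x) = (∫ a, y a * Real.exp (x a) ∂ν) / ∫ a, Real.exp (x a) ∂ν := by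
  rw [integral_tilted, ← integral_div]
  refine integral_congr_ae (Filter.Eventually.of_forall fun a => ?_)
  simp only [smul_eq_mul]
  ring

lemma IsBddMeas.isProbabilityMeasure_tilted {X : Type*} [MeasurableSpace X] {ν : Measure X}
    [IsProbabilityMeasure ν] {x : X → ℝ} (hx : IsBddMeas x) :
    IsProbabilityMeasure (ν.tilted x) :=
  MeasureTheory.isProbabilityMeasure_tilted (hx.exp.integrable ν)

/-- Tilting by a function `x` of size `t` changes means by the covariance with `x`, up to
`O(t²)`. -/
lemma abs_integral_tilted_sub_cov_le {X : Type*} [MeasurableSpace X] (ν : Measure X)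
    [IsProbabilityMeasure ν] {x y : X → ℝ} (hx : IsBddMeas x) (hy : IsBddMeas y) {t b : ℝ}
    (ht : t ≤ 1 / 2) (hxt : ∀ a, |x a| ≤ t) (hyb : ∀ a, |y a| ≤ b) :
    |∫ a, y a ∂(ν.tilted x) - ∫ a, y a ∂ν - cov[x, y; ν]| ≤ 12 * b * t ^ 2 := by
  obtain ⟨a₀⟩ := nonempty_of_isProbabilityMeasure ν
  have ht0 : 0 ≤ t := (abs_nonneg _).trans (hxt a₀)
  have hb0 : 0 ≤ b := (abs_nonneg _).trans (hyb a₀)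
  set m := ∫ a, y a ∂ν with hm
  have hz : IsBddMeas (fun a => y a - m) := hy.sub (IsBddMeas.const m)
  have hzb : ∀ a, |y a - m| ≤ 2 * b := fun a => by
    have h1 := abs_integral_le_of_abs_le ν hyb
    calc |y a - m| ≤ |y a| + |m| := abs_sub _ _
      _ ≤ 2 * b := by linarith [hyb a]
  have hz0 : ∫ a, (y a - m) ∂ν = 0 := by
    rw [integral_sub (hy.integrable ν) (integrable_const _)]
    simp [hm]
  set c := ∫ a, (y a - m) * x a ∂ν with hc
  set N := ∫ a, (y a - m) * Real.exp (x a) ∂ν with hN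
  set Z := ∫ a, Real.exp (x a) ∂ν with hZ
  have hZpos : 0 < Z := integral_exp_pos_of_isBddMeas ν hx
  have hcov : cov[x, y; ν] = c := by
    rw [covariance]
    have : ∀ a, (x a - ∫ a, x a ∂ν) * (y a - m) = (y a - m) * x a - (∫ a, x a ∂ν) * (y a - m) :=
      fun a => by ring
    simp_rw [← hm, this]
    rw [integral_sub ((hz.mul hx).integrable ν) ((hz.const_mul _).integrable ν),
      integral_const_mul, hz0, mul_zero, sub_zero]
  have hmean : ∫ a, y a ∂(ν.tilted x) - m = N / Z := by
    have := hx.isProbabilityMeasure_tilted (ν := ν)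
    rw [hN, hZ, ← integral_tilted_eq_div, integral_sub (hy.integrable _) (integrable_const _)]
    simp
  have hNc : |N - c| ≤ 2 * b * t ^ 2 := by
    have : N - c = ∫ a, (y a - m) * (Real.exp (x a) - 1 - x a) ∂ν := by
      have e : ∀ a, (y a - m) * (Real.exp (x a) - 1 - x a) =
        (y a - m) * Real.exp (x a) - (y a - m) * x a - (y a - m) := fun a => by ring
      simp_rw [e]
      rw [integral_sub (((hz.mul hx.exp).sub (hz.mul hx)).integrable ν) (hz.integrable ν),
        integral_sub ((hz.mul hx.exp).integrable ν) ((hz.mul hx).integrable ν), hz0, sub_zero]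
    rw [this]
    refine abs_integral_le_of_abs_le ν fun a => ?_
    rw [abs_mul]
    refine mul_le_mul (hzb a) ?_ (abs_nonneg _) (by linarith)
    refine (Real.abs_exp_sub_one_sub_id_le ((hxt a).trans (by linarith))).trans ?_
    exact sq_le_sq' (by linarith [neg_abs_le (x a), hxt a]) ((le_abs_self _).trans (hxt a))
  have hcb : |c| ≤ 2 * b * t := abs_integral_le_of_abs_le ν fun a => by
    rw [abs_mul]
    exact mul_le_mul (hzb a) (hxt a) (abs_nonneg _) (by linarith)
  have hZ1 : |Z - 1| ≤ 2 * t := by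
    have : Z - 1 = ∫ a, (Real.exp (x a) - 1) ∂ν := by
      rw [integral_sub (hx.exp.integrable ν) (integrable_const _)]
      simp [hZ]
    rw [this]
    refine abs_integral_le_of_abs_le ν fun a => ?_
    exact (Real.abs_exp_sub_one_le ((hxt a).trans (by linarith))).trans (by linarith [hxt a])
  have hZhalf : 1 / 2 ≤ Z := by
    have : ∫ a, (1 + x a) ∂ν ≤ Z :=
      integral_mono (((IsBddMeas.const 1).add hx).integrable ν) (hx.exp.integrable ν)
        fun a => by linarith [Real.add_one_le_exp (x a)]
    rw [integral_add (integrable_const _) (hx.integrable ν)] at this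
    simp only [integral_const, probReal_univ, smul_eq_mul, mul_one] at this
    linarith [(abs_le.1 (abs_integral_le_of_abs_le ν hxt)).1]
  have hfin : N / Z - c = ((N - c) - c * (Z - 1)) / Z := by
    field_simp
    ring
  rw [hmean, hcov, hfin, abs_div, abs_of_pos hZpos, div_le_iff₀ hZpos]
  calc |N - c - c * (Z - 1)| ≤ |N - c| + |c| * |Z - 1| := by
        rw [← abs_mul]; exact abs_sub _ _
    _ ≤ 2 * b * t ^ 2 + 2 * b * t * (2 * t) := by
        refine add_le_add hNc (mul_le_mul hcb hZ1 (abs_nonneg _) (by positivity))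
    _ = 12 * b * t ^ 2 * (1 / 2) := by ring
    _ ≤ 12 * b * t ^ 2 * Z := by gcongr

lemma abs_covariance_le {X : Type*} [MeasurableSpace X] (ν : Measure X)
    [IsProbabilityMeasure ν] {x y : X → ℝ} {t b : ℝ}
    (hxt : ∀ a, |x a| ≤ t) (hyb : ∀ a, |y a| ≤ b) : |cov[x, y; ν]| ≤ 4 * b * t := by
  obtain ⟨a₀⟩ := nonempty_of_isProbabilityMeasure ν
  have ht0 : 0 ≤ t := (abs_nonneg _).trans (hxt a₀)
  refine abs_integral_le_of_abs_le ν fun a => ?_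
  rw [abs_mul]
  have h1 : |x a - ∫ a, x a ∂ν| ≤ 2 * t :=
    (abs_sub _ _).trans (by linarith [hxt a, abs_integral_le_of_abs_le ν hxt])
  have h2 : |y a - ∫ a, y a ∂ν| ≤ 2 * b :=
    (abs_sub _ _).trans (by linarith [hyb a, abs_integral_le_of_abs_le ν hyb])
  calc _ ≤ 2 * t * (2 * b) := mul_le_mul h1 h2 (abs_nonneg _) (by linarith)
    _ = 4 * b * t := by ring

/-! ### The smallest eigenvalue of a symmetric matrix -/

open Matrix in
lemma lambdaMin_mul_dotProduct_self_le {p : ℕ} {M : Matrix (Fin p) (Fin p) ℝ}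
    (hM : M.IsHermitian) (x : Fin p → ℝ) : lambdaMin M * (x ⬝ᵥ x) ≤ x ⬝ᵥ (M *ᵥ x) := by
  have hpsd : (M - algebraMap ℝ _ (lambdaMin M)).PosSemidef := by
    rw [posSemidef_iff_isHermitian_and_spectrum_nonneg]
    refine ⟨hM.sub ?_, ?_⟩
    · rw [algebraMap_eq_diagonal]
      exact isHermitian_diagonal _
    · rw [← spectrum.sub_singleton_eq]
      rintro _ ⟨l, hl, _, rfl, rfl⟩
      have : lambdaMin M ≤ l := csInf_le (M.finite_real_spectrum).bddBelow hl
      exact sub_nonneg.2 this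
  have h := hpsd.dotProduct_mulVec_nonneg x
  rw [sub_mulVec, dotProduct_sub, algebraMap_eq_diagonal] at h
  have e : (diagonal (algebraMap ℝ (Fin p → ℝ) (lambdaMin M))) *ᵥ x = lambdaMin M • x := by
    ext i
    simp [mulVec_diagonal]
  rw [e, dotProduct_smul] at h
  simpa using h

lemma lambdaMin_nonneg {p : ℕ} {M : Matrix (Fin p) (Fin p) ℝ} (hM : M.PosSemidef) :
    0 ≤ lambdaMin M :=
  Real.sInf_nonneg fun _ hl => (Matrix.posSemidef_iff_isHermitian_and_spectrum_nonneg.1 hM).2 hl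

namespace EntropyMDP

variable {S A : Type*} [MeasurableSpace S] [MeasurableSpace A] {p : ℕ} (M : EntropyMDP S A)

/-! ### Softmax policies -/

lemma isBddMeas_bddFun (f : BddFun S A) : IsBddMeas (Function.uncurry f.toFun) :=
  ⟨f.measurable', f.bounded'.imp fun _ h x => h x.1 x.2⟩

lemma isBddMeas_section {u : S × A → ℝ} (hu : IsBddMeas u) (s : S) :
    IsBddMeas (fun a => u (s, a)) :=
  hu.comp measurable_prodMk_left

lemma isBddMeas_cost : IsBddMeas (Function.uncurry M.c) :=
  ⟨M.measurable_c, 1, fun x => M.abs_c_le x.1 x.2⟩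

lemma policy_eq_tilted (f : BddFun S A) (s : S) : M.policy f s = M.μ.tilted (f s) :=
  M.policy_apply f s

/-- The log-partition function `s ↦ log ∫ exp f(s,a) μ(da)`. -/
noncomputable def logPartition (f : BddFun S A) (s : S) : ℝ := Real.log (∫ a, Real.exp (f s a) ∂M.μ)

lemma isBddMeas_log_integral_exp {u : S × A → ℝ} (hu : IsBddMeas u) :
    IsBddMeas (fun s => Real.log (∫ a, Real.exp (u (s, a)) ∂M.μ)) := by
  have hm := (hu.exp.integral_kernel_prod (Kernel.const S M.μ)).measurable.log
  simp only [Kernel.const_apply] at hm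
  obtain ⟨C, hC⟩ := hu.2
  refine ⟨hm, C, fun s => ?_⟩
  have hs := isBddMeas_section hu s
  have hpos := integral_exp_pos_of_isBddMeas M.μ hs
  rw [abs_le, Real.le_log_iff_exp_le hpos, Real.log_le_iff_le_exp hpos]
  constructor
  · have := integral_mono (integrable_const (Real.exp (-C))) (hs.exp.integrable M.μ)
      fun a => Real.exp_le_exp.2 (abs_le.1 (hC (s, a))).1
    simpa using this
  · exact integral_le_of_le hs.exp M.μ fun a => Real.exp_le_exp.2 (abs_le.1 (hC (s, a))).2

lemma isBddMeas_logPartition (f : BddFun S A) : IsBddMeas (M.logPartition f) :=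
  M.isBddMeas_log_integral_exp (isBddMeas_bddFun f)

lemma logDensity_eq (f : BddFun S A) (s : S) (a : A) :
    M.logDensity f s a = f s a - M.logPartition f s := by
  have hpos : 0 < ∫ a, Real.exp (f s a) ∂M.μ :=
    integral_exp_pos_of_isBddMeas M.μ (isBddMeas_section (isBddMeas_bddFun f) s)
  rw [logDensity, density, Real.log_div (Real.exp_pos _).ne' hpos.ne', Real.log_exp]
  rfl

lemma isBddMeas_logDensity (f : BddFun S A) : IsBddMeas (Function.uncurry (M.logDensity f)) := by
  have := (isBddMeas_bddFun f).sub ((M.isBddMeas_logPartition f).comp measurable_fst)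
  convert this using 2 with x
  exact M.logDensity_eq f x.1 x.2

lemma policy_absolutelyContinuous (f f' : BddFun S A) (s : S) : M.policy f s ≪ M.policy f' s := by
  rw [policy_eq_tilted, policy_eq_tilted]
  exact (tilted_absolutelyContinuous _ _).trans (absolutelyContinuous_tilted
    ((isBddMeas_section (isBddMeas_bddFun f') s).exp.integrable M.μ))

/-- Changing the exponent of a softmax policy tilts the policy by the difference. -/
lemma policy_eq_policy_tilted (f f' : BddFun S A) (s : S) :
    M.policy f' s = (M.policy f s).tilted (fun a => f' s a - f s a) := by
  have hint : Integrable (fun a => Real.exp (f s a)) M.μ :=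
    (isBddMeas_section (isBddMeas_bddFun f) s).exp.integrable M.μ
  rw [policy_eq_tilted, policy_eq_tilted, tilted_tilted hint]
  congr 1
  ext a
  simp

/-! ### State chain and occupancy measures -/

instance (f : BddFun S A) : IsMarkovKernel (M.stateKernel f) := by
  unfold stateKernel; infer_instance

instance isMarkovKernel_pow {X : Type*} [MeasurableSpace X] (κ : Kernel X X) [IsMarkovKernel κ]
    (n : ℕ) : IsMarkovKernel (κ ^ n) := by
  induction n with
  | zero => exact (inferInstance : IsMarkovKernel (Kernel.id : Kernel X X))
  | succ n ih =>
    rw [pow_succ]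
    exact (inferInstance : IsMarkovKernel ((κ ^ n) ∘ₖ κ))

lemma stateKernel_apply (f : BddFun S A) (s : S) :
    M.stateKernel f s = M.P ∘ₘ ((Measure.dirac s).prod (M.policy f s)) := by
  rw [stateKernel, Kernel.comp_apply, Kernel.prod_apply, Kernel.id_apply]

lemma integral_stateKernel (f : BddFun S A) {u : S → ℝ} (hu : IsBddMeas u) (s : S) :
    ∫ s', u s' ∂(M.stateKernel f s) = ∫ a, ∫ s', u s' ∂(M.P (s, a)) ∂(M.policy f s) := by
  rw [stateKernel_apply, hu.integral_bind, Measure.dirac_prod,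
    integral_map measurable_prodMk_left.aemeasurable
      (hu.integral_kernel M.P).measurable.aestronglyMeasurable]

lemma stateKernel_absolutelyContinuous (f f' : BddFun S A) (s : S) :
    M.stateKernel f s ≪ M.stateKernel f' s := by
  rw [stateKernel_apply, stateKernel_apply]
  exact (Measure.AbsolutelyContinuous.rfl.prod
    (M.policy_absolutelyContinuous f f' s)).comp_right M.P

/-- The law of `sₙ` when `s₀ ∼ ρ`. -/
noncomputable def stateLaw (f : BddFun S A) (ρ : Measure S) (n : ℕ) : Measure S :=
  ρ.bind ((M.stateKernel f) ^ n : Kernel S S)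

instance (f : BddFun S A) (ρ : Measure S) [IsProbabilityMeasure ρ] (n : ℕ) :
    IsProbabilityMeasure (M.stateLaw f ρ n) := by
  unfold stateLaw; infer_instance

lemma stateLaw_zero (f : BddFun S A) (ρ : Measure S) : M.stateLaw f ρ 0 = ρ := by
  rw [stateLaw, pow_zero]
  exact Measure.id_comp

lemma stateLaw_succ (f : BddFun S A) (ρ : Measure S) (n : ℕ) :
    M.stateLaw f ρ (n + 1) = M.stateKernel f ∘ₘ M.stateLaw f ρ n := by
  rw [stateLaw, pow_succ']
  exact Measure.comp_assoc.symm

lemma stateLaw_succ' (f : BddFun S A) (ρ : Measure S) (n : ℕ) :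
    M.stateLaw f ρ (n + 1) = M.stateLaw f (M.stateKernel f ∘ₘ ρ) n := by
  rw [stateLaw, pow_succ]
  exact Measure.comp_assoc.symm

lemma stateLaw_absolutelyContinuous (f f' : BddFun S A) (ρ : Measure S) (n : ℕ) :
    M.stateLaw f ρ n ≪ M.stateLaw f' ρ n := by
  induction n with
  | zero => rw [stateLaw_zero, stateLaw_zero]
  | succ n ih =>
    rw [stateLaw_succ, stateLaw_succ]
    exact ih.comp (Filter.Eventually.of_forall fun s => M.stateKernel_absolutelyContinuous f f' s)

lemma one_sub_gamma_pos : 0 < 1 - M.γ := sub_pos.2 M.γ_lt_one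

lemma occ_eq_sum (f : BddFun S A) (ρ : Measure S) :
    M.occ f ρ = Measure.sum fun n : ℕ =>
      ENNReal.ofReal ((1 - M.γ) * M.γ ^ n) • M.stateLaw f ρ n := by
  ext t ht
  have hn (n : ℕ) := Kernel.measurable_coe ((M.stateKernel f) ^ n) ht
  rw [occ, Measure.bind_apply ht (Kernel.aemeasurable _), Measure.sum_apply _ ht]
  have (s : S) : M.occKernel f s t =
      ∑' n : ℕ, ENNReal.ofReal ((1 - M.γ) * M.γ ^ n) * ((M.stateKernel f) ^ n) s t := by
    change (Measure.sum fun n : ℕ =>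
      ENNReal.ofReal ((1 - M.γ) * M.γ ^ n) • ((M.stateKernel f) ^ n) s) t = _
    simp_rw [Measure.sum_apply _ ht, Measure.smul_apply, smul_eq_mul]
  simp_rw [this]
  rw [lintegral_tsum fun n => ((hn n).const_mul _).aemeasurable]
  refine tsum_congr fun n => ?_
  rw [lintegral_const_mul _ (hn n), Measure.smul_apply, smul_eq_mul, stateLaw,
    Measure.bind_apply ht (Kernel.aemeasurable _)]

lemma hasSum_discount : HasSum (fun n : ℕ => (1 - M.γ) * M.γ ^ n) 1 := by
  have := (hasSum_geometric_of_lt_one M.γ_nonneg M.γ_lt_one).mul_left (1 - M.γ)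
  rwa [mul_inv_cancel₀ M.one_sub_gamma_pos.ne'] at this

lemma discount_nonneg (n : ℕ) : 0 ≤ (1 - M.γ) * M.γ ^ n :=
  mul_nonneg M.one_sub_gamma_pos.le (pow_nonneg M.γ_nonneg n)

instance (f : BddFun S A) (ρ : Measure S) [IsProbabilityMeasure ρ] :
    IsProbabilityMeasure (M.occ f ρ) := by
  refine ⟨?_⟩
  rw [occ_eq_sum, Measure.sum_apply _ MeasurableSet.univ]
  simp only [Measure.smul_apply, measure_univ, smul_eq_mul, mul_one]
  rw [← ENNReal.ofReal_tsum_of_nonneg M.discount_nonneg M.hasSum_discount.summable,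
    M.hasSum_discount.tsum_eq, ENNReal.ofReal_one]

lemma occ_dirac (f : BddFun S A) (s : S) : M.occ f (Measure.dirac s) = M.occKernel f s := by
  rw [occ, Measure.dirac_bind (Kernel.measurable _)]

instance (f : BddFun S A) : IsMarkovKernel (M.occKernel f) :=
  ⟨fun s => by rw [← occ_dirac]; infer_instance⟩

lemma smul_le_occ (f : BddFun S A) (ρ : Measure S) :
    ENNReal.ofReal (1 - M.γ) • ρ ≤ M.occ f ρ := by
  have := Measure.le_sum (fun n : ℕ =>
    ENNReal.ofReal ((1 - M.γ) * M.γ ^ n) • M.stateLaw f ρ n) 0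
  rw [← occ_eq_sum, stateLaw_zero] at this
  simpa using this

/-- All policies in the class are mutually absolutely continuous, hence so are their occupancy
measures. -/
lemma occ_absolutelyContinuous (f f' : BddFun S A) (ρ : Measure S) :
    M.occ f ρ ≪ M.occ f' ρ := by
  rw [occ_eq_sum M f, occ_eq_sum M f']
  refine Measure.absolutelyContinuous_sum_left fun n => Measure.absolutelyContinuous_sum_right n ?_
  exact (M.stateLaw_absolutelyContinuous f f' ρ n).smul _

lemma hasSum_integral_occ (f : BddFun S A) (ρ : Measure S) [IsProbabilityMeasure ρ]
    {u : S → ℝ} (hu : IsBddMeas u) :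
    HasSum (fun n : ℕ => (1 - M.γ) * M.γ ^ n * ∫ s, u s ∂(M.stateLaw f ρ n))
      (∫ s, u s ∂(M.occ f ρ)) := by
  have hi := hu.integrable (M.occ f ρ)
  rw [occ_eq_sum] at hi ⊢
  convert! hasSum_integral_measure hi using 2 with n
  rw [integral_smul_measure, ENNReal.toReal_ofReal (M.discount_nonneg n), smul_eq_mul]

/-- The flow equation of the occupancy measure, tested against a bounded function. -/
lemma integral_occ_sub_stateKernel (f : BddFun S A) (ρ : Measure S) [IsProbabilityMeasure ρ]
    {u : S → ℝ} (hu : IsBddMeas u) :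
    ∫ s, (u s - M.γ * ∫ s', u s' ∂(M.stateKernel f s)) ∂(M.occ f ρ) =
      (1 - M.γ) * ∫ s, u s ∂ρ := by
  have hK := hu.integral_kernel (M.stateKernel f)
  rw [integral_sub (hu.integrable _) ((hK.const_mul _).integrable _), integral_const_mul]
  have h1 := M.hasSum_integral_occ f ρ hu
  have h2 := (M.hasSum_integral_occ f ρ hK).mul_left M.γ
  have h3 := (hasSum_nat_add_iff' 1).2 h1
  have h4 : HasSum (fun n : ℕ => (1 - M.γ) * M.γ ^ (n + 1) * ∫ s, u s ∂(M.stateLaw f ρ (n + 1)))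
      (M.γ * ∫ s, ∫ s', u s' ∂(M.stateKernel f s) ∂(M.occ f ρ)) := by
    convert! h2 using 2 with n
    rw [stateLaw_succ, hu.integral_bind]
    ring
  have := h3.unique h4
  rw [← this]
  simp [stateLaw_zero]

/-- Conditioning on the first transition. -/
lemma integral_occKernel_eq (f : BddFun S A) {u : S → ℝ} (hu : IsBddMeas u) (s : S) :
    ∫ s', u s' ∂(M.occKernel f s) = (1 - M.γ) * u s +
      M.γ * ∫ s', ∫ s'', u s'' ∂(M.occKernel f s') ∂(M.stateKernel f s) := by
  rw [← occ_dirac]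
  have hbind : M.stateKernel f ∘ₘ Measure.dirac s = M.stateKernel f s :=
    Measure.dirac_bind (Kernel.measurable _) s
  have h1 := (hasSum_nat_add_iff' 1).2 (M.hasSum_integral_occ f (Measure.dirac s) hu)
  have h2 := (M.hasSum_integral_occ f (M.stateKernel f s) hu).mul_left M.γ
  rw [occ, hu.integral_bind] at h2
  have h3 : HasSum (fun n : ℕ => (1 - M.γ) * M.γ ^ (n + 1) *
      ∫ s', u s' ∂(M.stateLaw f (Measure.dirac s) (n + 1)))
      (M.γ * ∫ s', ∫ s'', u s'' ∂(M.occKernel f s') ∂(M.stateKernel f s)) := by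
    convert! h2 using 2 with n
    rw [stateLaw_succ', hbind]
    ring
  have := h1.unique h3
  rw [← this]
  simp [stateLaw_zero, integral_dirac' _ _ hu.measurable.stronglyMeasurable]

/-! ### The value function -/

/-- The expected one-step cost `∫ (c(s,a) + τ log dπ/dμ(a|s)) π(da|s)`. -/
noncomputable def stepCost (f : BddFun S A) (s : S) : ℝ :=
  ∫ a, (M.c s a + M.τ * M.logDensity f s a) ∂(M.policy f s)

lemma isBddMeas_regCost (f : BddFun S A) :
    IsBddMeas (fun x : S × A => M.c x.1 x.2 + M.τ * M.logDensity f x.1 x.2) :=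
  M.isBddMeas_cost.add ((M.isBddMeas_logDensity f).const_mul M.τ)

lemma isBddMeas_stepCost (f : BddFun S A) : IsBddMeas (M.stepCost f) :=
  (M.isBddMeas_regCost f).integral_kernel_prod (M.policy f)

instance (f : BddFun S A) (ρ : Measure S) [IsProbabilityMeasure ρ] :
    IsProbabilityMeasure (M.trajLaw f ρ) := by
  unfold trajLaw; infer_instance

lemma trajLaw_map_zero (f : BddFun S A) (ρ : Measure S) [IsProbabilityMeasure ρ] :
    (M.trajLaw f ρ).map (fun ω => ω 0) = ρ ⊗ₘ M.policy f := by
  have h : (M.trajLaw f ρ).map (Preorder.frestrictLe 0) =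
      (ρ ⊗ₘ M.policy f).map (MeasurableEquiv.piUnique fun _ : Finset.Iic 0 => S × A).symm := by
    rw [trajLaw, Kernel.trajMeasure, Measure.map_comp _ _ (by fun_prop),
      Kernel.traj_map_frestrictLe, Kernel.partialTraj_self, Measure.id_comp]
  have h2 := congrArg
    (fun m => Measure.map (MeasurableEquiv.piUnique fun _ : Finset.Iic 0 => S × A) m) h
  rw [Measure.map_map (by fun_prop) (by fun_prop), Measure.map_map (by fun_prop) (by fun_prop),
    MeasurableEquiv.self_comp_symm, Measure.map_id] at h2
  exact h2

lemma trajLaw_map_succ (f : BddFun S A) (ρ : Measure S) [IsProbabilityMeasure ρ] (n : ℕ) :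
    (M.trajLaw f ρ).map (fun ω => ω (n + 1)) =
      M.step f ∘ₘ ((M.trajLaw f ρ).map (fun ω => ω n)) := by
  have hφ : Measurable (fun h : (i : Finset.Iic n) → S × A => h ⟨n, Finset.mem_Iic.2 le_rfl⟩) :=
    measurable_pi_apply _
  have h := congrArg Measure.snd (Kernel.map_frestrictLe_trajMeasure_compProd_eq_map_trajMeasure
    (X := fun _ => S × A) (μ₀ := ρ ⊗ₘ M.policy f)
    (κ := fun n => (M.step f).comap (fun h => h ⟨n, Finset.mem_Iic.2 le_rfl⟩)
      (measurable_pi_apply _)) (a := n))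
  rw [Measure.snd_compProd, Measure.snd_map_prodMk (by fun_prop)] at h
  rw [trajLaw, ← h]
  ext t ht
  rw [Measure.bind_apply ht (Kernel.aemeasurable _), Measure.bind_apply ht (Kernel.aemeasurable _),
    lintegral_map (Kernel.measurable_coe _ ht) (by fun_prop),
    lintegral_map (Kernel.measurable_coe _ ht) (by fun_prop)]
  rfl

lemma step_comp_compProd (f : BddFun S A) (ρ : Measure S) [IsProbabilityMeasure ρ] :
    M.step f ∘ₘ (ρ ⊗ₘ M.policy f) = (M.stateKernel f ∘ₘ ρ) ⊗ₘ M.policy f := by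
  have hstate : M.stateKernel f ∘ₘ ρ = M.P ∘ₘ (ρ ⊗ₘ M.policy f) := by
    rw [Measure.compProd_eq_comp_prod, Measure.comp_assoc, stateKernel]
  ext t ht
  rw [hstate, Measure.bind_apply ht (Kernel.aemeasurable _), Measure.compProd_apply ht,
    Measure.lintegral_bind (Kernel.aemeasurable _)
      (Kernel.measurable_kernel_prodMk_left ht).aemeasurable]
  refine lintegral_congr fun x => ?_
  rw [step, Kernel.compProd_apply ht]
  rfl

lemma trajLaw_map (f : BddFun S A) (ρ : Measure S) [IsProbabilityMeasure ρ] (n : ℕ) :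
    (M.trajLaw f ρ).map (fun ω => ω n) = M.stateLaw f ρ n ⊗ₘ M.policy f := by
  induction n with
  | zero => rw [trajLaw_map_zero, stateLaw_zero]
  | succ n ih => rw [trajLaw_map_succ, ih, step_comp_compProd, stateLaw_succ]

/-- The value is the occupancy average of the one-step cost. -/
lemma value_eq_integral_occ (f : BddFun S A) (ρ : Measure S) [IsProbabilityMeasure ρ] :
    M.value f ρ = (1 - M.γ)⁻¹ * ∫ s, M.stepCost f s ∂(M.occ f ρ) := by
  have hk := M.isBddMeas_regCost f
  set k : S × A → ℝ := fun x => M.c x.1 x.2 + M.τ * M.logDensity f x.1 x.2 with hkdef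
  have hterm (n : ℕ) : IsBddMeas (fun ω : ℕ → S × A => M.γ ^ n * k (ω n)) :=
    (hk.comp (measurable_pi_apply n)).const_mul _
  obtain ⟨C, hC⟩ := hk.2
  have hsum : Summable fun n : ℕ => ∫ ω, ‖M.γ ^ n * k (ω n)‖ ∂(M.trajLaw f ρ) := by
    refine Summable.of_nonneg_of_le (fun n => integral_nonneg fun _ => norm_nonneg _) (fun n => ?_)
      ((summable_geometric_of_lt_one M.γ_nonneg M.γ_lt_one).mul_right C)
    refine (le_abs_self _).trans (abs_integral_le_of_abs_le _ fun ω => ?_)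
    rw [abs_norm, Real.norm_eq_abs, abs_mul, abs_of_nonneg (pow_nonneg M.γ_nonneg n)]
    exact mul_le_mul_of_nonneg_left (hC _) (pow_nonneg M.γ_nonneg n)
  have h1 := hasSum_integral_of_summable_integral_norm
    (fun n => (hterm n).integrable (M.trajLaw f ρ)) hsum
  have h2 := (M.hasSum_integral_occ f ρ (M.isBddMeas_stepCost f)).mul_left (1 - M.γ)⁻¹
  refine h1.unique ?_
  convert! h2 using 2 with n
  have : ∫ ω, k (ω n) ∂(M.trajLaw f ρ) = ∫ s, M.stepCost f s ∂(M.stateLaw f ρ n) := by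
    rw [← integral_map (φ := fun ω : ℕ → S × A => ω n) (measurable_pi_apply n).aemeasurable
      hk.measurable.aestronglyMeasurable, trajLaw_map,
      Measure.integral_compProd (hk.integrable _)]
    rfl
  rw [integral_const_mul, this, mul_assoc, inv_mul_cancel_left₀ M.one_sub_gamma_pos.ne']

lemma valueAt_eq (f : BddFun S A) (s : S) :
    M.valueAt f s = (1 - M.γ)⁻¹ * ∫ s', M.stepCost f s' ∂(M.occKernel f s) := by
  rw [valueAt, value_eq_integral_occ, occ_dirac]

lemma isBddMeas_valueAt (f : BddFun S A) : IsBddMeas (M.valueAt f) := by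
  simp_rw [funext (M.valueAt_eq f)]
  exact ((M.isBddMeas_stepCost f).integral_kernel _).const_mul _

lemma value_eq_integral_valueAt (f : BddFun S A) (ρ : Measure S) [IsProbabilityMeasure ρ] :
    M.value f ρ = ∫ s, M.valueAt f s ∂ρ := by
  simp_rw [valueAt_eq, integral_const_mul]
  rw [value_eq_integral_occ, occ, (M.isBddMeas_stepCost f).integral_bind]

/-! ### Bellman operators -/

/-- `c(s,a) + γ ∫ v(s') P(ds'|s,a)`. -/
noncomputable def lookahead (v : S → ℝ) (s : S) (a : A) : ℝ :=
  M.c s a + M.γ * ∫ s', v s' ∂(M.P (s, a))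

lemma isBddMeas_lookahead {v : S → ℝ} (hv : IsBddMeas v) :
    IsBddMeas (Function.uncurry (M.lookahead v)) :=
  M.isBddMeas_cost.add ((hv.integral_kernel M.P).const_mul M.γ)

lemma isBddMeas_lookahead_section {v : S → ℝ} (hv : IsBddMeas v) (s : S) :
    IsBddMeas (M.lookahead v s) :=
  isBddMeas_section (M.isBddMeas_lookahead hv) s

/-- The regularized Bellman operator `T_π` of the softmax policy `π` with exponent `f`. -/
noncomputable def bellman (f : BddFun S A) (v : S → ℝ) (s : S) : ℝ :=
  ∫ a, (M.lookahead v s a + M.τ * M.logDensity f s a) ∂(M.policy f s)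

lemma isBddMeas_bellman (f : BddFun S A) {v : S → ℝ} (hv : IsBddMeas v) :
    IsBddMeas (M.bellman f v) :=
  ((M.isBddMeas_lookahead hv).add
    ((M.isBddMeas_logDensity f).const_mul M.τ)).integral_kernel_prod (M.policy f)

lemma bellman_eq_stepCost_add (f : BddFun S A) {v : S → ℝ} (hv : IsBddMeas v) (s : S) :
    M.bellman f v s = M.stepCost f s + M.γ * ∫ s', v s' ∂(M.stateKernel f s) := by
  rw [integral_stateKernel _ _ hv, stepCost, ← integral_const_mul, ← integral_add
    ((isBddMeas_section (M.isBddMeas_regCost f) s).integrable _)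
    ((isBddMeas_section ((hv.integral_kernel M.P).const_mul M.γ) s).integrable _), bellman]
  refine integral_congr_ae (Filter.Eventually.of_forall fun a => ?_)
  simp only [lookahead]
  ring

lemma bellman_valueAt (f : BddFun S A) (s : S) :
    M.bellman f (M.valueAt f) s = M.valueAt f s := by
  rw [M.bellman_eq_stepCost_add f (M.isBddMeas_valueAt f)]
  simp_rw [valueAt_eq, integral_const_mul]
  rw [M.integral_occKernel_eq f (M.isBddMeas_stepCost f) s, mul_add,
    inv_mul_cancel_left₀ M.one_sub_gamma_pos.ne']
  ring

/-- The performance difference identity: the value of a policy minus an arbitrary bounded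
function is the occupancy average of the Bellman residual of that function. -/
lemma value_sub_integral (f : BddFun S A) (ρ : Measure S) [IsProbabilityMeasure ρ] {v : S → ℝ}
    (hv : IsBddMeas v) :
    M.value f ρ - ∫ s, v s ∂ρ = (1 - M.γ)⁻¹ * ∫ s, (M.bellman f v s - v s) ∂(M.occ f ρ) := by
  have h := M.integral_occ_sub_stateKernel f ρ hv
  have hK := (hv.integral_kernel (M.stateKernel f)).const_mul M.γ
  have e : ∀ s, M.bellman f v s - v s =
      M.stepCost f s - (v s - M.γ * ∫ s', v s' ∂(M.stateKernel f s)) := fun s => by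
    rw [M.bellman_eq_stepCost_add f hv]; ring
  simp_rw [e]
  rw [integral_sub ((M.isBddMeas_stepCost f).integrable _) ((hv.sub hK).integrable _), h, mul_sub,
    inv_mul_cancel_left₀ M.one_sub_gamma_pos.ne', value_eq_integral_occ]

/-- The soft Bellman optimality operator
`v ↦ -τ log ∫ exp(-(c + γ P v)/τ) dμ`. -/
noncomputable def softBellman (v : S → ℝ) (s : S) : ℝ :=
  -M.τ * Real.log (∫ a, Real.exp (-(1 / M.τ) * M.lookahead v s a) ∂M.μ)

lemma isBddMeas_softBellman {v : S → ℝ} (hv : IsBddMeas v) : IsBddMeas (M.softBellman v) :=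
  (M.isBddMeas_log_integral_exp ((M.isBddMeas_lookahead hv).const_mul _)).const_mul _

/-- The Gibbs variational principle with its deficit: a policy operator exceeds the soft
optimality operator by a relative entropy. -/
lemma bellman_eq_softBellman_add (f : BddFun S A) {v : S → ℝ} (hv : IsBddMeas v) (s : S) :
    M.bellman f v s = M.softBellman v s +
      M.τ * jensenGap (M.policy f s) (fun a => -(1 / M.τ) * M.lookahead v s a - f s a) := by
  have hτ := M.τ_pos.ne'
  have hf : IsBddMeas (f s) := isBddMeas_section (isBddMeas_bddFun f) s
  have hq := M.isBddMeas_lookahead_section hv s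
  have hZ := integral_exp_pos_of_isBddMeas M.μ hf
  have hE := integral_exp_pos_of_isBddMeas M.μ (hq.const_mul (-(1 / M.τ)))
  have hexp : ∫ a, Real.exp (-(1 / M.τ) * M.lookahead v s a - f s a) ∂(M.policy f s) =
      (∫ a, Real.exp (-(1 / M.τ) * M.lookahead v s a) ∂M.μ) / ∫ a, Real.exp (f s a) ∂M.μ := by
    rw [policy_eq_tilted, integral_tilted_eq_div]
    simp_rw [← Real.exp_add, sub_add_cancel]
  rw [jensenGap, hexp, Real.log_div hE.ne' hZ.ne', softBellman, bellman]
  simp_rw [logDensity_eq]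
  rw [integral_add (hq.integrable _) (((hf.sub (IsBddMeas.const _)).const_mul _).integrable _),
    integral_const_mul, integral_sub (hf.integrable _) (integrable_const _),
    integral_sub ((hq.const_mul _).integrable _) (hf.integrable _), integral_const_mul]
  simp only [integral_const, probReal_univ, smul_eq_mul, one_mul, logPartition]
  field_simp
  ring

lemma softBellman_le_bellman (f : BddFun S A) {v : S → ℝ} (hv : IsBddMeas v) (s : S) :
    M.softBellman v s ≤ M.bellman f v s := by
  rw [M.bellman_eq_softBellman_add f hv]
  have hf : IsBddMeas (f s) := isBddMeas_section (isBddMeas_bddFun f) s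
  have := jensenGap_nonneg (M.policy f s)
    (((M.isBddMeas_lookahead_section hv s).const_mul (-(1 / M.τ))).sub hf)
  have := mul_nonneg M.τ_pos.le this
  linarith

/-! ### Optimality -/

lemma softBellman_le_add {v w : S → ℝ} (hv : IsBddMeas v) (hw : IsBddMeas w) {D : ℝ}
    (h : ∀ s, v s ≤ w s + D) (s : S) : M.softBellman v s ≤ M.softBellman w s + M.γ * D := by
  have hτ := M.τ_pos
  have hqv := (M.isBddMeas_lookahead_section hv s).const_mul (-(1 / M.τ))
  have hqw := (M.isBddMeas_lookahead_section hw s).const_mul (-(1 / M.τ))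
  have hle (a : A) : M.lookahead v s a ≤ M.lookahead w s a + M.γ * D := by
    have : ∫ s', v s' ∂(M.P (s, a)) ≤ ∫ s', w s' ∂(M.P (s, a)) + D := by
      have := integral_mono (hv.integrable (M.P (s, a)))
        ((hw.add (IsBddMeas.const D)).integrable (M.P (s, a))) h
      rw [integral_add (hw.integrable _) (integrable_const _)] at this
      simpa using this
    have := mul_le_mul_of_nonneg_left this M.γ_nonneg
    simp only [lookahead]
    linarith
  have hlog : Real.log (∫ a, Real.exp (-(1 / M.τ) * M.lookahead w s a) ∂M.μ) +
      -(1 / M.τ) * (M.γ * D) ≤ Real.log (∫ a, Real.exp (-(1 / M.τ) * M.lookahead v s a) ∂M.μ) := by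
    rw [Real.le_log_iff_exp_le (integral_exp_pos_of_isBddMeas M.μ hqv), Real.exp_add,
      Real.exp_log (integral_exp_pos_of_isBddMeas M.μ hqw), ← integral_mul_const]
    refine integral_mono ((hqw.exp.integrable M.μ).mul_const _) (hqv.exp.integrable M.μ) fun a => ?_
    rw [← Real.exp_add]
    refine Real.exp_le_exp.2 ?_
    have := mul_le_mul_of_nonneg_left (hle a) (one_div_pos.2 hτ).le
    linarith
  have := mul_le_mul_of_nonneg_left hlog hτ.le
  have e : M.τ * (-(1 / M.τ) * (M.γ * D)) = -(M.γ * D) := by field_simp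
  simp only [softBellman]
  rw [mul_add, e] at this
  linarith

lemma abs_softBellman_sub_le {v w : S → ℝ} (hv : IsBddMeas v) (hw : IsBddMeas w) {D : ℝ}
    (h : ∀ s, |v s - w s| ≤ D) (s : S) :
    |M.softBellman v s - M.softBellman w s| ≤ M.γ * D := by
  rw [abs_sub_le_iff]
  have h1 := M.softBellman_le_add hv hw (D := D) (fun s => by linarith [(abs_le.1 (h s)).2]) s
  have h2 := M.softBellman_le_add hw hv (D := D) (fun s => by linarith [(abs_le.1 (h s)).1]) s
  exact ⟨by linarith, by linarith⟩

/-- The soft Bellman operator is a `γ`-contraction in the supremum norm, and its fixed point is the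
limit of value iteration. -/
lemma exists_softBellman_fixedPoint : ∃ v : S → ℝ, IsBddMeas v ∧ ∀ s, M.softBellman v s = v s := by
  have hγ := M.γ_lt_one
  let u : ℕ → S → ℝ := fun n => M.softBellman^[n] (fun _ => 0)
  have hu0 (s : S) : u 0 s = 0 := rfl
  have husucc (n : ℕ) : u (n + 1) = M.softBellman (u n) := Function.iterate_succ_apply' _ _ _
  have hu (n : ℕ) : IsBddMeas (u n) := by
    induction n with
    | zero => exact IsBddMeas.const 0
    | succ n ih => rw [husucc]; exact M.isBddMeas_softBellman ih
  obtain ⟨C, hC⟩ := (hu 1).2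
  have hstep (n : ℕ) (s : S) : |u n s - u (n + 1) s| ≤ C * M.γ ^ n := by
    induction n generalizing s with
    | zero => simpa [hu0] using hC s
    | succ n ih =>
      have := M.abs_softBellman_sub_le (hu n) (hu (n + 1)) ih s
      rw [husucc n, husucc (n + 1)]
      calc _ ≤ _ := this
        _ = _ := by ring
  have hlim (s : S) : ∃ l, Filter.Tendsto (fun n => u n s) Filter.atTop (nhds l) :=
    cauchySeq_tendsto_of_complete
      (cauchySeq_of_le_geometric M.γ C hγ fun n => by rw [Real.dist_eq]; exact hstep n s)
  choose v hv using hlim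
  have hdist (n : ℕ) (s : S) : |u n s - v s| ≤ C * M.γ ^ n / (1 - M.γ) := by
    have := dist_le_of_le_geometric_of_tendsto M.γ C hγ
      (fun n => by rw [Real.dist_eq]; exact hstep n s) (hv s) n
    rwa [Real.dist_eq] at this
  have hvb : IsBddMeas v := by
    refine ⟨measurable_of_tendsto_metrizable (fun n => (hu n).measurable)
      (tendsto_pi_nhds.2 hv), C * M.γ ^ 0 / (1 - M.γ), fun s => ?_⟩
    simpa [hu0] using hdist 0 s
  refine ⟨v, hvb, fun s => ?_⟩
  refine tendsto_nhds_unique ?_ ((Filter.tendsto_add_atTop_iff_nat 1).2 (hv s))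
  rw [tendsto_iff_dist_tendsto_zero]
  have hgeo : Filter.Tendsto (fun n : ℕ => M.γ * (C * M.γ ^ n / (1 - M.γ))) Filter.atTop
      (nhds 0) := by
    have := ((tendsto_pow_atTop_nhds_zero_of_lt_one M.γ_nonneg hγ).const_mul C).div_const
      (1 - M.γ) |>.const_mul M.γ
    simpa using this
  refine squeeze_zero (fun _ => dist_nonneg) (fun n => ?_) hgeo
  rw [husucc n, Real.dist_eq]
  exact M.abs_softBellman_sub_le (hu n) hvb (hdist n) s

/-- An optimal policy in the class is the softmax of `-Q*/τ`. -/
lemma exists_optimal : ∃ f : BddFun S A, (∀ f' s, M.valueAt f s ≤ M.valueAt f' s) ∧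
    (∀ s, M.valueAt f s = M.optValue s) ∧ ∀ s a, f s a = -(1 / M.τ) * M.optQ s a := by
  obtain ⟨v, hv, hfix⟩ := M.exists_softBellman_fixedPoint
  have hq := (M.isBddMeas_lookahead hv).const_mul (-(1 / M.τ))
  let f : BddFun S A :=
    ⟨fun s a => -(1 / M.τ) * M.lookahead v s a, hq.1, hq.2.imp fun _ h s a => h (s, a)⟩
  have hdir (f' : BddFun S A) (s : S) : M.valueAt f' s - v s =
      (1 - M.γ)⁻¹ * ∫ s', (M.bellman f' v s' - v s') ∂(M.occ f' (Measure.dirac s)) := by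
    rw [← M.value_sub_integral f' _ hv, integral_dirac' _ _ hv.measurable.stronglyMeasurable]
    rfl
  have hlow (f' : BddFun S A) (s : S) : v s ≤ M.valueAt f' s := by
    rw [← sub_nonneg, hdir]
    refine mul_nonneg (inv_nonneg.2 M.one_sub_gamma_pos.le) (integral_nonneg fun s' => ?_)
    have := M.softBellman_le_bellman f' hv s'
    rw [hfix] at this
    exact sub_nonneg.2 this
  have heq (s : S) : M.valueAt f s = v s := by
    have (s' : S) : M.bellman f v s' - v s' = 0 := by
      rw [M.bellman_eq_softBellman_add f hv, hfix]
      have : (fun a => -(1 / M.τ) * M.lookahead v s' a - f s' a) = fun _ => 0 :=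
        funext fun a => sub_self _
      rw [this, jensenGap_const]
      ring
    rw [← sub_eq_zero, hdir]
    simp [this]
  have hopt (s : S) : M.optValue s = v s := by
    have : Nonempty (BddFun S A) := ⟨f⟩
    refine le_antisymm ?_ (le_ciInf fun f' => hlow f' s)
    rw [← heq s]
    exact ciInf_le ⟨v s, by rintro _ ⟨f', rfl⟩; exact hlow f' s⟩ f
  refine ⟨f, fun f' s => (heq s).trans_le (hlow f' s), fun s => (heq s).trans (hopt s).symm,
    fun s a => ?_⟩
  have : M.optValue = v := funext hopt
  rw [optQ, this]
  rfl

lemma bddFun_ext {f f' : BddFun S A} (h : ∀ s a, f s a = f' s a) : f = f' := by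
  cases f
  cases f'
  congr
  exact funext fun s => funext fun a => h s a

/-- Under realizability the optimal parameter exists and is unique, since `Q*` is the state-action
value of the optimal policy. -/
lemma existsUnique_isOptParam {g : Features S A p} (hQ : M.Realizable g) :
    ∃! θs : EuclideanSpace ℝ (Fin p), M.IsOptParam g θs := by
  obtain ⟨f, -, hval, -⟩ := M.exists_optimal
  have hq : M.qValue f = M.optQ := by
    ext s a
    simp only [qValue, optQ, hval]
  simpa only [IsOptParam, hq] using hQ f

lemma valueAt_isOptParam {g : Features S A p} {θs : EuclideanSpace ℝ (Fin p)}
    (hθs : M.IsOptParam g θs) :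
    (∀ f' s, M.valueAt (g.logit θs) s ≤ M.valueAt f' s) ∧
      ∀ s, M.valueAt (g.logit θs) s = M.optValue s := by
  obtain ⟨f, hle, hval, hf⟩ := M.exists_optimal
  have : g.logit θs = f := bddFun_ext fun s a => (hθs s a).trans (hf s a).symm
  rw [this]
  exact ⟨hle, hval⟩

/-- The exponent `-Q^f/τ - f` by which the softmax policy with exponent `f` has to be tilted to
become greedy with respect to its own state-action value, that is, proportional to
`exp(-Q^f/τ) μ`. Up to a function of the state it is the advantage function divided by `-τ`. -/
noncomputable def greedyTilt (f : BddFun S A) (s : S) (a : A) : ℝ :=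
  -(1 / M.τ) * M.qValue f s a - f s a

lemma isBddMeas_greedyTilt (f : BddFun S A) : IsBddMeas (Function.uncurry (M.greedyTilt f)) :=
  ((M.isBddMeas_lookahead (M.isBddMeas_valueAt f)).const_mul _).sub (isBddMeas_bddFun f)

/-- The Jensen gap of `greedyTilt`: the relative entropy of the softmax policy with exponent `f`
with respect to its greedy policy. -/
noncomputable def greedyGap (f : BddFun S A) (s : S) : ℝ :=
  jensenGap (M.policy f s) (M.greedyTilt f s)

lemma tau_mul_greedyGap (f : BddFun S A) (s : S) :
    M.τ * M.greedyGap f s = M.valueAt f s - M.softBellman (M.valueAt f) s := by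
  have h := M.bellman_eq_softBellman_add f (M.isBddMeas_valueAt f) s
  rw [bellman_valueAt] at h
  have : M.greedyGap f s = jensenGap (M.policy f s)
      (fun a => -(1 / M.τ) * M.lookahead (M.valueAt f) s a - f s a) := rfl
  rw [this]
  linarith

lemma isBddMeas_greedyGap (f : BddFun S A) : IsBddMeas (M.greedyGap f) := by
  have h := ((M.isBddMeas_valueAt f).sub
    (M.isBddMeas_softBellman (M.isBddMeas_valueAt f))).const_mul M.τ⁻¹
  convert h using 2 with s
  rw [← tau_mul_greedyGap, inv_mul_cancel_left₀ M.τ_pos.ne']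

/-- The suboptimality of one policy with respect to any other is at most the average of its
distance from the greedy policy, over the states visited by the other one. -/
lemma value_sub_value_le (f f' : BddFun S A) (ρ : Measure S) [IsProbabilityMeasure ρ] :
    M.value f ρ - M.value f' ρ ≤
      M.τ / (1 - M.γ) * ∫ s, M.greedyGap f s ∂(M.occ f' ρ) := by
  have hv := M.isBddMeas_valueAt f
  have h := M.value_sub_integral f' ρ hv
  rw [← value_eq_integral_valueAt] at h
  have hle : -∫ s, M.τ * M.greedyGap f s ∂(M.occ f' ρ) ≤
      ∫ s, (M.bellman f' (M.valueAt f) s - M.valueAt f s) ∂(M.occ f' ρ) := by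
    rw [← integral_neg]
    refine integral_mono (((M.isBddMeas_greedyGap f).const_mul M.τ).neg.integrable _)
      (((M.isBddMeas_bellman f' hv).sub hv).integrable _) fun s => ?_
    have := M.softBellman_le_bellman f' hv s
    simp only [tau_mul_greedyGap]
    linarith
  have := mul_le_mul_of_nonneg_left hle (inv_nonneg.2 M.one_sub_gamma_pos.le)
  rw [← h, integral_const_mul] at this
  rw [div_eq_mul_inv]
  linarith

end EntropyMDP

/-! ### Jensen gaps and covariances under a change of policy -/

/-- The effect on the Jensen gap of moving the base measure along `x`. -/
lemma jensenGap_tilted_sub {X : Type*} [MeasurableSpace X] (ν : Measure X)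
    [IsProbabilityMeasure ν] {x w : X → ℝ} (hx : IsBddMeas x) (hw : IsBddMeas w) :
    jensenGap (ν.tilted x) (fun a => w a - x a) = jensenGap ν w
      - (∫ a, w a ∂(ν.tilted x) - ∫ a, w a ∂ν) + jensenGap (ν.tilted x) (fun a => -x a) := by
  have := hx.isProbabilityMeasure_tilted (ν := ν)
  have hZ := integral_exp_pos_of_isBddMeas ν hx
  have hW := integral_exp_pos_of_isBddMeas ν hw
  have h1 : ∫ a, Real.exp (w a - x a) ∂(ν.tilted x) =
      (∫ a, Real.exp (w a) ∂ν) / ∫ a, Real.exp (x a) ∂ν := by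
    rw [integral_tilted_eq_div]
    simp_rw [← Real.exp_add, sub_add_cancel]
  have h2 : ∫ a, Real.exp (-x a) ∂(ν.tilted x) = 1 / ∫ a, Real.exp (x a) ∂ν := by
    rw [integral_tilted_eq_div]
    simp_rw [← Real.exp_add, neg_add_cancel]
    simp
  simp only [jensenGap]
  rw [h1, h2, Real.log_div hW.ne' hZ.ne', Real.log_div one_ne_zero hZ.ne', Real.log_one,
    integral_sub (hw.integrable _) (hx.integrable _), integral_neg]
  ring

lemma IsBddMeas.covariance {X Y : Type*} [MeasurableSpace X] [MeasurableSpace Y]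
    {u v : X × Y → ℝ} (hu : IsBddMeas u) (hv : IsBddMeas v) (κ : Kernel X Y) [IsMarkovKernel κ] :
    IsBddMeas (fun x => cov[fun y => u (x, y), fun y => v (x, y); κ x]) := by
  have h := ((hu.mul hv).integral_kernel_prod κ).sub
    ((hu.integral_kernel_prod κ).mul (hv.integral_kernel_prod κ))
  convert h using 2 with x
  rw [covariance_eq_sub ((hu.comp measurable_prodMk_left).memLp _ 2)
    ((hv.comp measurable_prodMk_left).memLp _ 2)]
  rfl

namespace EntropyMDP

variable {S A : Type*} [MeasurableSpace S] [MeasurableSpace A] {p : ℕ} (M : EntropyMDP S A)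

/-! ### First-order expansion of the value -/

lemma abs_bellman_sub_bellman_add_cov_le (f f' : BddFun S A) {b t ε : ℝ} (ht : t ≤ 1 / 2)
    (hb : ∀ s a, |M.greedyTilt f s a| ≤ b) (hx : ∀ s a, |f' s a - f s a| ≤ t) {v : S → ℝ}
    (hv : IsBddMeas v) (hε : ∀ s, |v s - M.valueAt f s| ≤ ε) (s : S) :
    |M.bellman f' v s - M.bellman f v s +
      M.τ * cov[fun a => f' s a - f s a, M.greedyTilt f s; M.policy f s]| ≤
      M.τ * (12 * b + 1) * t ^ 2 + 10 * ε * t := by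
  have hτ := M.τ_pos
  obtain ⟨a₀⟩ := nonempty_of_isProbabilityMeasure M.μ
  have ht0 : 0 ≤ t := (abs_nonneg _).trans (hx s a₀)
  have hε0 : 0 ≤ ε := (abs_nonneg _).trans (hε s)
  have hV := M.isBddMeas_valueAt f
  set ν := M.policy f s with hν
  set x : A → ℝ := fun a => f' s a - f s a with hxdef
  have hxm : IsBddMeas x :=
    (isBddMeas_section (isBddMeas_bddFun f') s).sub (isBddMeas_section (isBddMeas_bddFun f) s)
  have hν' : M.policy f' s = ν.tilted x := M.policy_eq_policy_tilted f f' s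
  have := hxm.isProbabilityMeasure_tilted (ν := ν)
  -- The part of the tilt of `v` that is not the greedy tilt of `f` is small.
  set e : A → ℝ := fun a => M.γ * ∫ s', (v s' - M.valueAt f s') ∂(M.P (s, a)) with he
  have hem : IsBddMeas e :=
    isBddMeas_section (((hv.sub hV).integral_kernel M.P).const_mul M.γ) s
  have heb : ∀ a, |e a| ≤ ε := fun a => by
    rw [he, abs_mul, abs_of_nonneg M.γ_nonneg]
    calc M.γ * |∫ s', (v s' - M.valueAt f s') ∂(M.P (s, a))| ≤ 1 * ε :=
          mul_le_mul M.γ_lt_one.le (abs_integral_le_of_abs_le _ hε) (abs_nonneg _) zero_le_one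
      _ = ε := one_mul ε
  have hd : IsBddMeas (M.greedyTilt f s) := isBddMeas_section (M.isBddMeas_greedyTilt f) s
  set w : A → ℝ := fun a => M.greedyTilt f s a - (1 / M.τ) * e a with hw
  have hwm : IsBddMeas w := hd.sub (hem.const_mul _)
  have hlook (a : A) : M.lookahead v s a = M.qValue f s a + e a := by
    simp only [he, lookahead, qValue]
    rw [integral_sub (hv.integrable _) (hV.integrable _)]
    ring
  have hwf : (fun a => -(1 / M.τ) * M.lookahead v s a - f s a) = w := by
    ext a
    rw [hlook, hw]
    simp only [greedyTilt]
    ring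
  have hwf' : (fun a => -(1 / M.τ) * M.lookahead v s a - f' s a) = fun a => w a - x a := by
    rw [← hwf]
    ext a
    simp only [hxdef]
    ring
  set g₀ := jensenGap (ν.tilted x) (fun a => -x a) with hg₀
  have hg₀n : 0 ≤ g₀ := jensenGap_nonneg _ hxm.neg
  have hg₀le : g₀ ≤ t ^ 2 / 2 :=
    jensenGap_le_half_sq _ hxm.neg fun a => by rw [abs_neg]; exact hx s a
  have hdiff : M.bellman f' v s - M.bellman f v s = M.τ * (g₀ -
      (∫ a, M.greedyTilt f s a ∂(ν.tilted x) - ∫ a, M.greedyTilt f s a ∂ν)) +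
      (∫ a, e a ∂(ν.tilted x) - ∫ a, e a ∂ν) := by
    have hmean (η : Measure A) [IsProbabilityMeasure η] : M.τ * ∫ a, w a ∂η =
        M.τ * ∫ a, M.greedyTilt f s a ∂η - ∫ a, e a ∂η := by
      simp only [hw]
      rw [integral_sub (hd.integrable _) ((hem.const_mul _).integrable _), integral_const_mul]
      field_simp
    have := hmean ν
    have := hmean (ν.tilted x)
    rw [M.bellman_eq_softBellman_add f' hv, M.bellman_eq_softBellman_add f hv, hwf, hwf', hν',
      jensenGap_tilted_sub ν hxm hwm, ← hg₀, ← hν]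
    linarith
  have h1 := abs_integral_tilted_sub_cov_le ν hxm hd ht (hx s) (hb s)
  have h2 := abs_integral_tilted_sub_cov_le ν hxm hem ht (hx s) heb
  have h3 := abs_covariance_le ν (hx s) heb
  have h4 : |∫ a, e a ∂(ν.tilted x) - ∫ a, e a ∂ν| ≤ 10 * ε * t := by
    have : 12 * ε * t ^ 2 ≤ 6 * ε * t := by
      have := mul_le_mul_of_nonneg_left ht (by positivity : 0 ≤ 12 * ε * t)
      nlinarith
    rw [abs_le] at h2 h3 ⊢
    constructor <;> linarith [h2.1, h2.2, h3.1, h3.2]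
  rw [hdiff]
  rw [abs_le] at h1 h4 ⊢
  have h5 := mul_le_mul_of_nonneg_left h1.1 hτ.le
  have h6 := mul_le_mul_of_nonneg_left h1.2 hτ.le
  have h7 := mul_le_mul_of_nonneg_left hg₀le hτ.le
  have h8 := mul_nonneg hτ.le hg₀n
  have h9 : 0 ≤ M.τ * t ^ 2 := by positivity
  constructor
  · linarith [h4.1]
  · linarith [h4.2]

/-- The policy gradient formula for the softmax parametrization, with a quadratic remainder. -/
lemma exists_abs_value_sub_le (f : BddFun S A) (ρ : Measure S) [IsProbabilityMeasure ρ] :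
    ∃ K : ℝ, ∀ (f' : BddFun S A) (t : ℝ), t ≤ 1 / 2 → (∀ s a, |f' s a - f s a| ≤ t) →
      |M.value f' ρ - M.value f ρ + M.τ / (1 - M.γ) *
        ∫ s, cov[fun a => f' s a - f s a, M.greedyTilt f s; M.policy f s] ∂(M.occ f ρ)| ≤
        K * t ^ 2 := by
  obtain ⟨b, hb'⟩ := (M.isBddMeas_greedyTilt f).2
  have hb : ∀ s a, |M.greedyTilt f s a| ≤ b := fun s a => hb' (s, a)
  have hτ := M.τ_pos
  have hγ := inv_pos.2 M.one_sub_gamma_pos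
  obtain ⟨a₀⟩ := nonempty_of_isProbabilityMeasure M.μ
  obtain ⟨s₀⟩ := nonempty_of_isProbabilityMeasure ρ
  have hb0 : 0 ≤ b := (abs_nonneg _).trans (hb s₀ a₀)
  set L : ℝ := (1 - M.γ)⁻¹ * (M.τ * (10 * b + 1)) with hL
  refine ⟨(1 - M.γ)⁻¹ * (M.τ * (12 * b + 1) + 10 * L), fun f' t ht hx => ?_⟩
  have ht0 : 0 ≤ t := (abs_nonneg _).trans (hx s₀ a₀)
  have hVf := M.isBddMeas_valueAt f
  have hVf' := M.isBddMeas_valueAt f'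
  -- A crude bound of order `t` on the difference of the two value functions.
  have hcrude (s : S) : |M.valueAt f' s - M.valueAt f s| ≤ L * t := by
    have h1 := M.value_sub_integral f' (Measure.dirac s) hVf
    rw [integral_dirac' _ _ hVf.measurable.stronglyMeasurable] at h1
    change M.valueAt f' s - M.valueAt f s = _ at h1
    rw [h1, abs_mul, abs_of_pos hγ, hL, mul_assoc]
    refine mul_le_mul_of_nonneg_left (abs_integral_le_of_abs_le _ fun s' => ?_) hγ.le
    have h2 := M.abs_bellman_sub_bellman_add_cov_le f f' ht hb hx hVf (ε := 0) (by simp) s'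
    have h3 := abs_covariance_le (M.policy f s') (hx s') (hb s')
    rw [bellman_valueAt] at h2
    have h4 : M.τ * (12 * b + 1) * t ^ 2 ≤ M.τ * (12 * b + 1) * t * (1 / 2) := by
      have := mul_le_mul_of_nonneg_left ht (by positivity : 0 ≤ M.τ * (12 * b + 1) * t)
      nlinarith
    rw [abs_le] at h2 h3 ⊢
    have h5 := mul_le_mul_of_nonneg_left h3.1 hτ.le
    have h6 := mul_le_mul_of_nonneg_left h3.2 hτ.le
    have h7 : 0 ≤ M.τ * t := by positivity
    constructor
    · linarith [h2.1]
    · linarith [h2.2]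
  have hcov : IsBddMeas fun s =>
      cov[fun a => f' s a - f s a, M.greedyTilt f s; M.policy f s] :=
    ((isBddMeas_bddFun f').sub (isBddMeas_bddFun f)).covariance (M.isBddMeas_greedyTilt f) _
  have h1 := M.value_sub_integral f ρ hVf'
  rw [← value_eq_integral_valueAt] at h1
  have hT := (M.isBddMeas_bellman f hVf').sub hVf'
  have h2 : M.value f' ρ - M.value f ρ + M.τ / (1 - M.γ) *
        ∫ s, cov[fun a => f' s a - f s a, M.greedyTilt f s; M.policy f s] ∂(M.occ f ρ) =
      (1 - M.γ)⁻¹ * ∫ s, (M.bellman f' (M.valueAt f') s - M.bellman f (M.valueAt f') s +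
      M.τ * cov[fun a => f' s a - f s a, M.greedyTilt f s; M.policy f s]) ∂(M.occ f ρ) := by
    have : ∀ s, M.bellman f' (M.valueAt f') s - M.bellman f (M.valueAt f') s +
        M.τ * cov[fun a => f' s a - f s a, M.greedyTilt f s; M.policy f s] =
        M.τ * cov[fun a => f' s a - f s a, M.greedyTilt f s; M.policy f s] -
        (M.bellman f (M.valueAt f') s - M.valueAt f' s) := fun s => by
      rw [bellman_valueAt]; ring
    simp_rw [this]
    rw [integral_sub ((hcov.const_mul _).integrable _) (hT.integrable _), integral_const_mul,
      mul_sub, ← h1]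
    ring
  rw [h2, abs_mul, abs_of_pos hγ, mul_assoc]
  refine mul_le_mul_of_nonneg_left (abs_integral_le_of_abs_le _ fun s => ?_) hγ.le
  have := M.abs_bellman_sub_bellman_add_cov_le f f' ht hb hx hVf' hcrude s
  calc _ ≤ _ := this
    _ = _ := by ring

end EntropyMDP

/-! ### Gradients in the parameter -/

/-- A first-order expansion with quadratic remainder determines the gradient. -/
lemma hasGradientAt_of_abs_sub_le {E : Type*} [NormedAddCommGroup E] [InnerProductSpace ℝ E]
    [CompleteSpace E] {F : E → ℝ} {v θ : E} {K : ℝ}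
    (hF : ∀ h : E, ‖h‖ ≤ 1 / 2 → |F (θ + h) - F θ - ⟪v, h⟫| ≤ K * ‖h‖ ^ 2) :
    HasGradientAt F v θ := by
  rw [hasGradientAt_iff_isLittleO_nhds_zero]
  refine Asymptotics.IsBigO.trans_isLittleO (g := fun h : E => ‖h‖ ^ 2) ?_
    (Asymptotics.isLittleO_norm_pow_id one_lt_two)
  refine Asymptotics.IsBigO.of_bound K ?_
  filter_upwards [Metric.closedBall_mem_nhds (0 : E) (by norm_num : (0 : ℝ) < 1 / 2)] with h hh
  rw [mem_closedBall_zero_iff] at hh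
  simpa using hF h hh

namespace EntropyMDP

variable {S A : Type*} [MeasurableSpace S] [MeasurableSpace A] {p : ℕ} (M : EntropyMDP S A)
  (g : Features S A p) (θ : EuclideanSpace ℝ (Fin p))

lemma logit_add_sub (h : EuclideanSpace ℝ (Fin p)) (s : S) (a : A) :
    g.logit (θ + h) s a - g.logit θ s a = g.logit h s a := by
  change ⟪θ + h, g s a⟫ - ⟪θ, g s a⟫ = ⟪h, g s a⟫
  rw [inner_add_left, add_sub_cancel_left]

lemma abs_logit_le (h : EuclideanSpace ℝ (Fin p)) (s : S) (a : A) : |g.logit h s a| ≤ ‖h‖ :=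
  (abs_real_inner_le_norm _ _).trans (mul_le_of_le_one_right (norm_nonneg _) (g.norm_le_one s a))

lemma isBddMeas_logit_section (h : EuclideanSpace ℝ (Fin p)) (s : S) : IsBddMeas (g.logit h s) :=
  isBddMeas_section (isBddMeas_bddFun (g.logit h)) s

/-- The directional derivative of the value of the log-linear policy, up to the factor
`-τ/(1-γ)`: the occupancy average of the covariance of `⟨h, g⟩` with the greedy tilt. -/
noncomputable def tiltCov (ρ : Measure S) [IsProbabilityMeasure ρ] :
    EuclideanSpace ℝ (Fin p) →ₗ[ℝ] ℝ where
  toFun h := ∫ s, cov[g.logit h s, M.greedyTilt (g.logit θ) s; M.policy (g.logit θ) s]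
    ∂(M.occ (g.logit θ) ρ)
  map_add' h h' := by
    have hB (k : EuclideanSpace ℝ (Fin p)) : Integrable (fun s => cov[g.logit k s,
        M.greedyTilt (g.logit θ) s; M.policy (g.logit θ) s]) (M.occ (g.logit θ) ρ) :=
      ((isBddMeas_bddFun (g.logit k)).covariance
        (M.isBddMeas_greedyTilt (g.logit θ)) (M.policy (g.logit θ))).integrable _
    rw [← integral_add (hB h) (hB h')]
    refine integral_congr_ae (Filter.Eventually.of_forall fun s => ?_)
    have : g.logit (h + h') s = g.logit h s + g.logit h' s := funext fun a => inner_add_left _ _ _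
    simp only [this]
    exact covariance_add_left ((isBddMeas_logit_section g h s).memLp _ 2)
      ((isBddMeas_logit_section g h' s).memLp _ 2)
      ((isBddMeas_section (M.isBddMeas_greedyTilt _) s).memLp _ 2)
  map_smul' c h := by
    rw [RingHom.id_apply, smul_eq_mul, ← integral_const_mul]
    refine integral_congr_ae (Filter.Eventually.of_forall fun s => ?_)
    have : g.logit (c • h) s = c • g.logit h s := funext fun a => real_inner_smul_left _ _ _
    simp only [this]
    exact covariance_smul_left c

lemma tiltCov_apply (ρ : Measure S) [IsProbabilityMeasure ρ] (h : EuclideanSpace ℝ (Fin p)) :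
    M.tiltCov g θ ρ h = ∫ s, cov[g.logit h s, M.greedyTilt (g.logit θ) s; M.policy (g.logit θ) s]
      ∂(M.occ (g.logit θ) ρ) := rfl

lemma exists_hasGradientAt_value (ρ : Measure S) [IsProbabilityMeasure ρ] :
    ∃ v, HasGradientAt (fun ϑ => M.value (g.logit ϑ) ρ) v θ ∧
      ∀ h, ⟪v, h⟫ = -(M.τ / (1 - M.γ) * M.tiltCov g θ ρ h) := by
  set ℓ := (-(M.τ / (1 - M.γ))) • (M.tiltCov g θ ρ)
  set v := (InnerProductSpace.toDual ℝ (EuclideanSpace ℝ (Fin p))).symm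
    (LinearMap.toContinuousLinearMap ℓ) with hv
  have hinner (h) : ⟪v, h⟫ = -(M.τ / (1 - M.γ) * M.tiltCov g θ ρ h) := by
    rw [hv, InnerProductSpace.toDual_symm_apply]
    simp [ℓ]
  obtain ⟨K, hK⟩ := M.exists_abs_value_sub_le (g.logit θ) ρ
  refine ⟨v, hasGradientAt_of_abs_sub_le (K := K) fun h hh => ?_, hinner⟩
  have := hK (g.logit (θ + h)) ‖h‖ hh fun s a => by
    rw [logit_add_sub]; exact abs_logit_le g h s a
  simp_rw [logit_add_sub] at this
  rw [hinner, sub_neg_eq_add]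
  exact this

/-- The score is the centred feature vector. -/
lemma score_eq (s : S) (a : A) :
    M.score g θ s a = g s a - ∫ a', g s a' ∂(M.policy (g.logit θ) s) := by
  set ν := M.policy (g.logit θ) s with hν
  refine HasGradientAt.gradient (hasGradientAt_of_abs_sub_le (K := 1 / 2) fun h _ => ?_)
  have hgm : Measurable (g s) := g.measurable'.comp measurable_prodMk_left
  have hgi : Integrable (g s) ν := Integrable.of_bound hgm.aestronglyMeasurable 1
    (Filter.Eventually.of_forall (g.norm_le_one s))
  have hh := isBddMeas_logit_section g h s
  have hmean : ⟪∫ a', g s a' ∂ν, h⟫ = ∫ a', g.logit h s a' ∂ν := by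
    rw [real_inner_comm, ← integral_inner hgi]
    rfl
  have hpart : M.logPartition (g.logit (θ + h)) s - M.logPartition (g.logit θ) s =
      Real.log (∫ a', Real.exp (g.logit h s a') ∂ν) := by
    have hθ := isBddMeas_logit_section g θ s
    rw [hν, policy_eq_tilted, integral_tilted_eq_div, logPartition, logPartition,
      ← Real.log_div (integral_exp_pos_of_isBddMeas M.μ (isBddMeas_logit_section g _ s)).ne'
      (integral_exp_pos_of_isBddMeas M.μ hθ).ne']
    simp_rw [← Real.exp_add, ← logit_add_sub g θ h, sub_add_cancel]
  have hexp : M.logDensity (g.logit (θ + h)) s a - M.logDensity (g.logit θ) s a -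
      ⟪g s a - ∫ a', g s a' ∂ν, h⟫ = -jensenGap ν (g.logit h s) := by
    have e : ⟪g s a, h⟫ = g.logit h s a := real_inner_comm _ _
    rw [inner_sub_left, hmean, e, jensenGap, ← hpart, logDensity_eq, logDensity_eq,
      ← logit_add_sub g θ h s a]
    ring
  rw [hexp, abs_neg, abs_of_nonneg (jensenGap_nonneg ν hh)]
  calc _ ≤ _ := jensenGap_le_half_sq ν hh (abs_logit_le g h s)
    _ = _ := by ring

end EntropyMDP

/-! ### Second moment matrices -/

section SecondMoment

variable {X : Type*} [MeasurableSpace X] {p : ℕ} (ν : Measure X) [IsProbabilityMeasure ν]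
  {φ : X → EuclideanSpace ℝ (Fin p)} {C : ℝ}

open Matrix in
lemma dotProduct_secondMoment_mulVec (hφ : Measurable φ) (hC : ∀ a, ‖φ a‖ ≤ C) (x : Fin p → ℝ) :
    x ⬝ᵥ ((Matrix.of fun i j => ∫ a, φ a i * φ a j ∂ν) *ᵥ x) =
      ∫ a, ⟪WithLp.toLp 2 x, φ a⟫ ^ 2 ∂ν := by
  have hcoord (i : Fin p) : IsBddMeas fun a => φ a i := by
    refine ⟨by fun_prop, C, fun a => ?_⟩
    rw [← Real.norm_eq_abs]
    exact (PiLp.norm_apply_le (φ a) i).trans (hC a)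
  have hsq : ∀ a, ⟪WithLp.toLp 2 x, φ a⟫ ^ 2 = ∑ i, ∑ j, x i * (x j * (φ a i * φ a j)) := by
    intro a
    have : ⟪WithLp.toLp 2 x, φ a⟫ = ∑ i, x i * φ a i := by
      simp [PiLp.inner_apply, mul_comm]
    rw [this, sq, Finset.sum_mul_sum]
    refine Finset.sum_congr rfl fun i _ => Finset.sum_congr rfl fun j _ => ?_
    ring
  simp_rw [hsq]
  rw [integral_finsetSum _ fun i _ => integrable_finsetSum _ fun j _ =>
    ((((hcoord i).mul (hcoord j)).const_mul _).const_mul _).integrable ν]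
  simp only [dotProduct, mulVec, Matrix.of_apply, Finset.mul_sum]
  refine Finset.sum_congr rfl fun i _ => ?_
  rw [integral_finsetSum _ fun j _ =>
    ((((hcoord i).mul (hcoord j)).const_mul _).const_mul _).integrable ν]
  refine Finset.sum_congr rfl fun j _ => ?_
  rw [integral_const_mul, integral_const_mul]
  ring

lemma isHermitian_secondMoment (ν : Measure X) (φ : X → EuclideanSpace ℝ (Fin p)) :
    (Matrix.of fun i j => ∫ a, φ a i * φ a j ∂ν).IsHermitian := by
  ext i j
  simp [mul_comm]

lemma lambdaMin_secondMoment_mul_le (hφ : Measurable φ) (hC : ∀ a, ‖φ a‖ ≤ C)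
    (x : EuclideanSpace ℝ (Fin p)) :
    lambdaMin (Matrix.of fun i j => ∫ a, φ a i * φ a j ∂ν) * ‖x‖ ^ 2 ≤
      ∫ a, ⟪x, φ a⟫ ^ 2 ∂ν := by
  have h := lambdaMin_mul_dotProduct_self_le (isHermitian_secondMoment ν φ) x.ofLp
  rw [dotProduct_secondMoment_mulVec ν hφ hC] at h
  have hn : x.ofLp ⬝ᵥ x.ofLp = ‖x‖ ^ 2 := by
    rw [EuclideanSpace.real_norm_sq_eq]
    simp [dotProduct, sq]
  rwa [hn] at h

lemma lambdaMin_secondMoment_nonneg (hφ : Measurable φ) (hC : ∀ a, ‖φ a‖ ≤ C) :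
    0 ≤ lambdaMin (Matrix.of fun i j => ∫ a, φ a i * φ a j ∂ν) := by
  refine lambdaMin_nonneg (Matrix.PosSemidef.of_dotProduct_mulVec_nonneg
    (isHermitian_secondMoment ν φ) fun x => ?_)
  have := dotProduct_secondMoment_mulVec ν hφ hC x
  simp only [star_trivial, this]
  exact integral_nonneg fun a => sq_nonneg _

end SecondMoment

/-! ### The supremum of a density -/

section DensitySup

variable {S : Type*} [MeasurableSpace S] {ν ρ : Measure S}

lemma le_densitySup_smul [SigmaFinite ν] [SigmaFinite ρ] (h : densitySup ν ρ ≠ ⊤) :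
    ν ≤ densitySup ν ρ • ρ := by
  have hac : ν ≪ ρ := by
    by_contra hac
    exact h (if_neg hac)
  have hD : densitySup ν ρ = essSup (ν.rnDeriv ρ) ρ := if_pos hac
  calc ν = ρ.withDensity (ν.rnDeriv ρ) := (Measure.withDensity_rnDeriv_eq ν ρ hac).symm
    _ ≤ ρ.withDensity (fun _ => densitySup ν ρ) := by
        refine withDensity_mono ?_
        rw [hD]
        exact ae_le_essSup
    _ = densitySup ν ρ • ρ := withDensity_const _

lemma one_le_densitySup [IsProbabilityMeasure ν] [IsProbabilityMeasure ρ] :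
    1 ≤ densitySup ν ρ := by
  by_cases h : densitySup ν ρ = ⊤
  · rw [h]; exact le_top
  · have := le_densitySup_smul h Set.univ
    simpa using this

end DensitySup

namespace EntropyMDP

variable {S A : Type*} [MeasurableSpace S] [MeasurableSpace A] {p : ℕ} (M : EntropyMDP S A)
  (g : Features S A p) (θ : EuclideanSpace ℝ (Fin p))

/-! ### Fisher information and feature covariance -/

lemma measurable_features_section (s : S) : Measurable (g s) :=
  g.measurable'.comp measurable_prodMk_left

lemma measurable_score_section (s : S) : Measurable (M.score g θ s) := by
  simp_rw [funext (M.score_eq g θ s)]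
  exact (measurable_features_section g s).sub_const _

lemma norm_score_le (s : S) (a : A) : ‖M.score g θ s a‖ ≤ 2 := by
  rw [score_eq]
  have h1 := norm_integral_le_of_norm_le_const (μ := M.policy (g.logit θ) s) (f := g s) (C := 1)
    (Filter.Eventually.of_forall (g.norm_le_one s))
  simp only [probReal_univ, mul_one] at h1
  exact (norm_sub_le _ _).trans (by linarith [g.norm_le_one s a])

/-- The variance of `⟨x, g⟩` is the quadratic form of the Fisher information at `x`. -/
lemma lambdaMin_fisher_mul_le (x : EuclideanSpace ℝ (Fin p)) (s : S) :
    lambdaMin (M.fisher g θ s) * ‖x‖ ^ 2 ≤ Var[g.logit x s; M.policy (g.logit θ) s] := by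
  refine (lambdaMin_secondMoment_mul_le (M.policy (g.logit θ) s)
    (M.measurable_score_section g θ s) (M.norm_score_le g θ s) x).trans_eq ?_
  have hgi : Integrable (g s) (M.policy (g.logit θ) s) :=
    Integrable.of_bound (measurable_features_section g s).aestronglyMeasurable 1
      (Filter.Eventually.of_forall (g.norm_le_one s))
  rw [variance_eq_integral (isBddMeas_logit_section g x s).measurable.aemeasurable]
  refine integral_congr_ae (Filter.Eventually.of_forall fun a => ?_)
  simp only [score_eq, inner_sub_right]
  rw [← integral_inner hgi]
  rfl

lemma lambdaMin_fisher_nonneg (s : S) : 0 ≤ lambdaMin (M.fisher g θ s) :=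
  lambdaMin_secondMoment_nonneg (M.policy (g.logit θ) s)
    (M.measurable_score_section g θ s) (M.norm_score_le g θ s)

lemma lambdaMin_featureCov_nonneg (s : S) : 0 ≤ lambdaMin (M.featureCov g θ s) :=
  lambdaMin_secondMoment_nonneg (M.policy (g.logit θ) s)
    (measurable_features_section g s) (g.norm_le_one s)

/-- For simplex features the vector `1` is in the kernel of the Fisher information, but on its
orthogonal complement the Fisher information is bounded below by the uncentred covariance:
the variance of `⟨x, g⟩` is the second moment of `⟨x - c1, g⟩` with `c` the mean, and
`‖x - c1‖ ≥ ‖x‖` if `x ⊥ 1`. -/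
lemma lambdaMin_featureCov_mul_le (hg : g.IsSimplex) {x : EuclideanSpace ℝ (Fin p)}
    (hx : ∑ i, x i = 0) (s : S) :
    lambdaMin (M.featureCov g θ s) * ‖x‖ ^ 2 ≤ Var[g.logit x s; M.policy (g.logit θ) s] := by
  set ν := M.policy (g.logit θ) s with hν
  set c := ∫ a, g.logit x s a ∂ν with hc
  set one : EuclideanSpace ℝ (Fin p) := WithLp.toLp 2 (fun _ => 1) with hone
  have hort : ⟪x, one⟫ = 0 := by
    rw [hone]
    simpa [PiLp.inner_apply] using hx
  have hones (a : A) : ⟪one, g s a⟫ = 1 := by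
    rw [hone]
    simpa [PiLp.inner_apply] using (hg s a).1
  have hnorm : ‖x‖ ^ 2 ≤ ‖x - c • one‖ ^ 2 := by
    rw [norm_sub_sq_real, real_inner_smul_right, hort]
    nlinarith [sq_nonneg ‖c • one‖]
  calc lambdaMin (M.featureCov g θ s) * ‖x‖ ^ 2
      ≤ lambdaMin (M.featureCov g θ s) * ‖x - c • one‖ ^ 2 :=
        mul_le_mul_of_nonneg_left hnorm (M.lambdaMin_featureCov_nonneg g θ s)
    _ ≤ ∫ a, ⟪x - c • one, g s a⟫ ^ 2 ∂ν :=
        lambdaMin_secondMoment_mul_le ν (measurable_features_section g s) (g.norm_le_one s) _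
    _ = Var[g.logit x s; ν] := by
        rw [variance_eq_integral (isBddMeas_logit_section g x s).measurable.aemeasurable]
        refine integral_congr_ae (Filter.Eventually.of_forall fun a => ?_)
        simp only [inner_sub_left, real_inner_smul_left, hones, mul_one]
        rfl

lemma isBddMeas_variance (x : EuclideanSpace ℝ (Fin p)) :
    IsBddMeas fun s => Var[g.logit x s; M.policy (g.logit θ) s] := by
  have h := (isBddMeas_bddFun (g.logit x)).covariance (isBddMeas_bddFun (g.logit x))
    (M.policy (g.logit θ))
  convert h using 2 with s
  exact (covariance_self (isBddMeas_logit_section g x s).measurable.aemeasurable).symm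

/-- No measurability of `κ` is needed: if `κ` is not integrable, the left-hand side vanishes. -/
lemma integral_mul_le_integral_variance {κ : S → ℝ} (η : Measure S) [IsProbabilityMeasure η]
    (x : EuclideanSpace ℝ (Fin p)) (hκ : ∀ s, 0 ≤ κ s)
    (h : ∀ s, κ s * ‖x‖ ^ 2 ≤ Var[g.logit x s; M.policy (g.logit θ) s]) :
    (∫ s, κ s ∂η) * ‖x‖ ^ 2 ≤ ∫ s, Var[g.logit x s; M.policy (g.logit θ) s] ∂η := by
  rw [← integral_mul_const]
  exact integral_mono_of_nonneg
    (Filter.Eventually.of_forall fun s => mul_nonneg (hκ s) (sq_nonneg _))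
    ((M.isBddMeas_variance g θ x).integrable η) (Filter.Eventually.of_forall h)

/-- Change of occupancy measure: `d^{π'}_ρ ≤ D ρ ≤ D / (1-γ) d^π_ρ`, with `D` the supremum of the
density of `d^{π'}_ρ`. -/
lemma integral_occ_le_densitySup_mul (f f' : BddFun S A) (ρ : Measure S) [IsProbabilityMeasure ρ]
    (hD : densitySup (M.occ f' ρ) ρ ≠ ⊤) {u : S → ℝ} (hu : IsBddMeas u) (hu0 : ∀ s, 0 ≤ u s) :
    ∫ s, u s ∂(M.occ f' ρ) ≤
      (densitySup (M.occ f' ρ) ρ).toReal / (1 - M.γ) * ∫ s, u s ∂(M.occ f ρ) := by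
  set D := densitySup (M.occ f' ρ) ρ with hDdef
  have h1 : ∫ s, u s ∂(M.occ f' ρ) ≤ D.toReal * ∫ s, u s ∂ρ := by
    rw [← smul_eq_mul, ← integral_smul_measure]
    exact integral_mono_measure (le_densitySup_smul hD) (Filter.Eventually.of_forall hu0)
      ((hu.integrable ρ).smul_measure hD)
  have h2 : (1 - M.γ) * ∫ s, u s ∂ρ ≤ ∫ s, u s ∂(M.occ f ρ) := by
    rw [← ENNReal.toReal_ofReal M.one_sub_gamma_pos.le, ← smul_eq_mul, ← integral_smul_measure]
    exact integral_mono_measure (M.smul_le_occ f ρ) (Filter.Eventually.of_forall hu0)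
      (hu.integrable _)
  have h3 : ∫ s, u s ∂ρ ≤ (1 - M.γ)⁻¹ * ∫ s, u s ∂(M.occ f ρ) :=
    (le_inv_mul_iff₀ M.one_sub_gamma_pos).2 h2
  calc _ ≤ _ := h1
    _ ≤ D.toReal * ((1 - M.γ)⁻¹ * ∫ s, u s ∂(M.occ f ρ)) :=
        mul_le_mul_of_nonneg_left h3 ENNReal.toReal_nonneg
    _ = _ := by ring

/-! ### The Polyak–Łojasiewicz inequality -/

/-- `δ` is a compatible parameter for the log-linear policy `π_θ`: tilting by `⟨δ, g⟩` makes the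
policy greedy, up to an additive constant in the exponent. Then `-τ/(1-γ) δ` is a natural gradient
direction. -/
def IsCompatible (δ : EuclideanSpace ℝ (Fin p)) : Prop :=
  ∃ m : ℝ, ∀ s a, M.greedyTilt (g.logit θ) s a = g.logit δ s a + m

variable {M g θ}

lemma Realizable.exists_isCompatible (hQ : M.Realizable g) : ∃ δ, M.IsCompatible g θ δ := by
  obtain ⟨θ', hθ', -⟩ := hQ (g.logit θ)
  refine ⟨θ' - θ, 0, fun s a => ?_⟩
  change -(1 / M.τ) * M.qValue (g.logit θ) s a - ⟪θ, g s a⟫ = ⟪θ' - θ, g s a⟫ + 0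
  rw [← hθ', inner_sub_left, add_zero]

/-- With simplex features a compatible parameter may be projected to the orthogonal complement of
`1`. -/
lemma IsCompatible.exists_sum_eq_zero (hg : g.IsSimplex) {δ : EuclideanSpace ℝ (Fin p)}
    (hδ : M.IsCompatible g θ δ) : ∃ δ', M.IsCompatible g θ δ' ∧ ∑ i, δ' i = 0 := by
  obtain ⟨m, hm⟩ := hδ
  rcases Nat.eq_zero_or_pos p with rfl | hp
  · exact ⟨δ, ⟨m, hm⟩, by simp⟩
  set c : ℝ := (∑ i, δ i) / p with hc
  set one : EuclideanSpace ℝ (Fin p) := WithLp.toLp 2 (fun _ => 1) with hone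
  have hones (s : S) (a : A) : ⟪one, g s a⟫ = 1 := by
    rw [hone]
    simpa [PiLp.inner_apply] using (hg s a).1
  refine ⟨δ - c • one, ⟨m + c, fun s a => ?_⟩, ?_⟩
  · rw [hm]
    change ⟪δ, g s a⟫ + m = ⟪δ - c • one, g s a⟫ + (m + c)
    rw [inner_sub_left, real_inner_smul_left, hones]
    ring
  · have : (p : ℝ) ≠ 0 := by positivity
    simp [hone, hc]
    field_simp
    simp

namespace IsCompatible

variable {δ : EuclideanSpace ℝ (Fin p)}

lemma greedyGap_eq (hδ : M.IsCompatible g θ δ) (s : S) :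
    M.greedyGap (g.logit θ) s = jensenGap (M.policy (g.logit θ) s) (g.logit δ s) := by
  obtain ⟨m, hm⟩ := hδ
  rw [greedyGap, funext (hm s), jensenGap_add_const _ (isBddMeas_logit_section g δ s)]

lemma greedyGap_le (hδ : M.IsCompatible g θ δ) (s : S) :
    M.greedyGap (g.logit θ) s ≤ ‖δ‖ ^ 2 / 2 := by
  rw [hδ.greedyGap_eq]
  exact jensenGap_le_half_sq _ (isBddMeas_logit_section g δ s) (abs_logit_le g δ s)

lemma greedyGap_eq_zero (hδ : M.IsCompatible g θ δ) {s : S}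
    (h : Var[g.logit δ s; M.policy (g.logit θ) s] = 0) : M.greedyGap (g.logit θ) s = 0 := by
  rw [hδ.greedyGap_eq, jensenGap_congr (ae_eq_integral_of_variance_eq_zero
    ((isBddMeas_logit_section g δ s).memLp _ 2) h), jensenGap_const]

lemma tiltCov_self (hδ : M.IsCompatible g θ δ) (ρ : Measure S) [IsProbabilityMeasure ρ] :
    M.tiltCov g θ ρ δ =
      ∫ s, Var[g.logit δ s; M.policy (g.logit θ) s] ∂(M.occ (g.logit θ) ρ) := by
  obtain ⟨m, hm⟩ := hδ
  rw [tiltCov_apply]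
  refine integral_congr_ae (Filter.Eventually.of_forall fun s => ?_)
  have h := isBddMeas_logit_section g δ s
  simp only [funext (hm s)]
  rw [covariance_add_const_right (h.integrable _), covariance_self h.measurable.aemeasurable]

/-- Pairing the policy gradient with a compatible parameter gives the average variance. -/
lemma integral_variance_le (hδ : M.IsCompatible g θ δ) (ρ : Measure S) [IsProbabilityMeasure ρ] :
    M.τ / (1 - M.γ) *
        ∫ s, Var[g.logit δ s; M.policy (g.logit θ) s] ∂(M.occ (g.logit θ) ρ) ≤
      ‖gradient (fun ϑ => M.value (g.logit ϑ) ρ) θ‖ * ‖δ‖ := by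
  obtain ⟨v, hv, hinner⟩ := M.exists_hasGradientAt_value g θ ρ
  rw [hv.gradient, ← hδ.tiltCov_self]
  have := hinner δ
  have h2 := neg_le_of_abs_le (abs_real_inner_le_norm v δ)
  linarith

/-- A critical parameter is optimal: at a critical point the policy is greedy in almost every
state it visits, and these are almost all states visited by any other policy. -/
lemma value_le_of_gradient_eq_zero (hδ : M.IsCompatible g θ δ) (ρ : Measure S)
    [IsProbabilityMeasure ρ] (h : gradient (fun ϑ => M.value (g.logit ϑ) ρ) θ = 0)
    (f' : BddFun S A) : M.value (g.logit θ) ρ - M.value f' ρ ≤ 0 := by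
  have hτγ : 0 < M.τ / (1 - M.γ) := div_pos M.τ_pos M.one_sub_gamma_pos
  have h0 := hδ.integral_variance_le ρ
  rw [h, norm_zero, zero_mul] at h0
  have hvar := M.isBddMeas_variance g θ δ
  have hnn : ∀ s, 0 ≤ Var[g.logit δ s; M.policy (g.logit θ) s] := fun s => variance_nonneg _ _
  have hint : ∫ s, Var[g.logit δ s; M.policy (g.logit θ) s] ∂(M.occ (g.logit θ) ρ) = 0 :=
    le_antisymm (nonpos_of_mul_nonpos_right h0 hτγ) (integral_nonneg hnn)
  have hae := (M.occ_absolutelyContinuous f' (g.logit θ) ρ).ae_le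
    ((integral_eq_zero_iff_of_nonneg hnn (hvar.integrable _)).1 hint)
  have hgap : ∫ s, M.greedyGap (g.logit θ) s ∂(M.occ f' ρ) = 0 := by
    refine integral_eq_zero_of_ae ?_
    filter_upwards [hae] with s hs using hδ.greedyGap_eq_zero hs
  have := M.value_sub_value_le (g.logit θ) f' ρ
  rwa [hgap, mul_zero] at this

/-- The quantitative step: a lower bound `Λ ‖δ‖²` for the average variance, up to the change of
measure factor `D / (1-γ)`, gives the inequality. -/
lemma value_sub_le_mul_sq (hδ : M.IsCompatible g θ δ) (ρ : Measure S) [IsProbabilityMeasure ρ]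
    (f' : BddFun S A) {D Λ : ℝ} (hD : 0 < D) (hΛ : 0 < Λ)
    (h : Λ * ‖δ‖ ^ 2 ≤ D / (1 - M.γ) *
      ∫ s, Var[g.logit δ s; M.policy (g.logit θ) s] ∂(M.occ (g.logit θ) ρ)) :
    M.value (g.logit θ) ρ - M.value f' ρ ≤
      1 / (2 * (1 - M.γ) * M.τ) * D ^ 2 * (Λ ^ 2)⁻¹ *
        ‖gradient (fun ϑ => M.value (g.logit ϑ) ρ) θ‖ ^ 2 := by
  have hτ := M.τ_pos
  have hγ := M.one_sub_gamma_pos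
  set N := ‖gradient (fun ϑ => M.value (g.logit ϑ) ρ) θ‖ with hN
  have hN0 : 0 ≤ N := norm_nonneg _
  have h1 : M.value (g.logit θ) ρ - M.value f' ρ ≤ M.τ / (1 - M.γ) * (‖δ‖ ^ 2 / 2) :=
    (M.value_sub_value_le (g.logit θ) f' ρ).trans (mul_le_mul_of_nonneg_left
      (integral_le_of_le (M.isBddMeas_greedyGap _) _ hδ.greedyGap_le) (by positivity))
  have h2 : M.τ * Λ * ‖δ‖ ^ 2 ≤ D * N * ‖δ‖ := by
    have h3 := mul_le_mul_of_nonneg_left (hδ.integral_variance_le ρ) hD.le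
    have h4 := mul_le_mul_of_nonneg_left h hτ.le
    calc _ = M.τ * (Λ * ‖δ‖ ^ 2) := by ring
      _ ≤ _ := h4
      _ = _ := by ring
      _ ≤ _ := h3
      _ = _ := by ring
  have h5 : M.τ * Λ * ‖δ‖ ≤ D * N := by
    rcases (norm_nonneg δ).eq_or_lt with h0 | h0
    · rw [← h0, mul_zero]; positivity
    · refine le_of_mul_le_mul_right ?_ h0
      calc _ = _ := by ring
        _ ≤ _ := h2
  have h6 : (M.τ * Λ * ‖δ‖) ^ 2 ≤ (D * N) ^ 2 := pow_le_pow_left₀ (by positivity) h5 2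
  refine h1.trans ?_
  calc M.τ / (1 - M.γ) * (‖δ‖ ^ 2 / 2)
      = 1 / (2 * (1 - M.γ) * M.τ) * (Λ ^ 2)⁻¹ * (M.τ * Λ * ‖δ‖) ^ 2 := by field_simp
    _ ≤ 1 / (2 * (1 - M.γ) * M.τ) * (Λ ^ 2)⁻¹ * (D * N) ^ 2 := by gcongr
    _ = _ := by ring

/-- Passage to the extended-real constant: where it is infinite, only the fact that critical
parameters are optimal is used. -/
lemma exists_plConst (hδ : M.IsCompatible g θ δ) (ρ : Measure S) [IsProbabilityMeasure ρ]
    (θs : EuclideanSpace ℝ (Fin p)) {R : ℝ} (hR : 0 ≤ R) {Λ : ℝ}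
    (h : densitySup (M.occ (g.logit θs) ρ) ρ ≠ ⊤ → Λ * ‖δ‖ ^ 2 ≤
      (densitySup (M.occ (g.logit θs) ρ) ρ).toReal / (1 - M.γ) *
        ∫ s, Var[g.logit δ s; M.policy (g.logit θ) s] ∂(M.occ (g.logit θ) ρ)) :
    ∃ C : ℝ, 0 < C ∧
      (M.plConst g ρ R θs ((ENNReal.ofReal Λ ^ 2)⁻¹) ≠ ⊤ →
        C = (M.plConst g ρ R θs ((ENNReal.ofReal Λ ^ 2)⁻¹)).toReal) ∧
      M.value (g.logit θ) ρ - M.value (g.logit θs) ρ ≤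
        C * ‖gradient (fun ϑ => M.value (g.logit ϑ) ρ) θ‖ ^ 2 := by
  have hτ := M.τ_pos
  have hγ := M.one_sub_gamma_pos
  set D := densitySup (M.occ (g.logit θs) ρ) ρ with hDdef
  set E := Real.exp (-max (2 / ((1 - M.γ) * M.τ) * (1 + M.γ * M.τ * R)) R) with hE
  have hE0 : 0 < E := Real.exp_pos _
  have hE1 : E ≤ 1 := Real.exp_le_one_iff.2 (neg_nonpos.2 (hR.trans (le_max_right _ _)))
  have hD1 : 1 ≤ D := one_le_densitySup
  have hK : M.plConst g ρ R θs ((ENNReal.ofReal Λ ^ 2)⁻¹) =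
    ENNReal.ofReal (1 / (2 * (1 - M.γ) * M.τ * E)) * D ^ 2 * (ENNReal.ofReal Λ ^ 2)⁻¹ := rfl
  have hA : 0 < 1 / (2 * (1 - M.γ) * M.τ * E) := by positivity
  rw [hK]
  by_cases hfin : D ≠ ⊤ ∧ 0 < Λ
  · obtain ⟨hDtop, hΛ⟩ := hfin
    have hD0 : 0 < D.toReal := ENNReal.toReal_pos (zero_lt_one.trans_le hD1).ne' hDtop
    have hreal : (ENNReal.ofReal (1 / (2 * (1 - M.γ) * M.τ * E)) * D ^ 2 *
        (ENNReal.ofReal Λ ^ 2)⁻¹).toReal =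
        1 / (2 * (1 - M.γ) * M.τ * E) * D.toReal ^ 2 * (Λ ^ 2)⁻¹ := by
      rw [ENNReal.toReal_mul, ENNReal.toReal_mul, ENNReal.toReal_ofReal hA.le, ENNReal.toReal_pow,
        ENNReal.toReal_inv, ENNReal.toReal_pow, ENNReal.toReal_ofReal hΛ.le]
    refine ⟨1 / (2 * (1 - M.γ) * M.τ * E) * D.toReal ^ 2 * (Λ ^ 2)⁻¹, by positivity,
      fun _ => hreal.symm, (hδ.value_sub_le_mul_sq ρ (g.logit θs) hD0 hΛ (h hDtop)).trans ?_⟩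
    have : 1 / (2 * (1 - M.γ) * M.τ) ≤ 1 / (2 * (1 - M.γ) * M.τ * E) :=
      one_div_le_one_div_of_le (by positivity) (mul_le_of_le_one_right (by positivity) hE1)
    gcongr
  · have htop : ENNReal.ofReal (1 / (2 * (1 - M.γ) * M.τ * E)) * D ^ 2 *
        (ENNReal.ofReal Λ ^ 2)⁻¹ = ⊤ := by
      have hA' : ENNReal.ofReal (1 / (2 * (1 - M.γ) * M.τ * E)) ≠ 0 := by
        simpa using hA
      have hD0 : D ^ 2 ≠ 0 := pow_ne_zero 2 (zero_lt_one.trans_le hD1).ne'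
      by_cases hDtop : D = ⊤
      · rw [hDtop, ENNReal.top_pow two_ne_zero, ENNReal.mul_top hA', ENNReal.top_mul]
        exact ENNReal.inv_ne_zero.2 (ENNReal.pow_ne_top ENNReal.ofReal_ne_top)
      · have hΛ : Λ ≤ 0 := not_lt.1 fun hΛ => hfin ⟨hDtop, hΛ⟩
        rw [ENNReal.ofReal_of_nonpos hΛ, zero_pow two_ne_zero, ENNReal.inv_zero,
          ENNReal.mul_top (mul_ne_zero hA' hD0)]
    set d := M.value (g.logit θ) ρ - M.value (g.logit θs) ρ with hd
    set N := ‖gradient (fun ϑ => M.value (g.logit ϑ) ρ) θ‖ with hN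
    have hNnn : 0 ≤ N := norm_nonneg _
    rcases hNnn.eq_or_lt with hN0 | hN0
    · refine ⟨1, one_pos, fun hne => absurd htop hne, ?_⟩
      rw [← hN0]
      rw [zero_pow two_ne_zero, mul_zero]
      exact hδ.value_le_of_gradient_eq_zero ρ (norm_eq_zero.1 hN0.symm) (g.logit θs)
    · refine ⟨|d| / N ^ 2 + 1, by positivity, fun hne => absurd htop hne, ?_⟩
      rw [add_mul, div_mul_cancel₀ _ (by positivity)]
      have : 0 ≤ 1 * N ^ 2 := by positivity
      linarith [le_abs_self d]

end IsCompatible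

end EntropyMDP

theorem mainTheorem3 {S A : Type*}
    [TopologicalSpace S] [PolishSpace S] [MeasurableSpace S] [BorelSpace S]
    [TopologicalSpace A] [PolishSpace A] [MeasurableSpace A] [BorelSpace A]
    {p : ℕ} (M : EntropyMDP S A) (g : Features S A p)
    (ρ : Measure S) [IsProbabilityMeasure ρ] (hQ : M.Realizable g) :
    (∃! θs : EuclideanSpace ℝ (Fin p), M.IsOptParam g θs) ∧
    ∀ θs : EuclideanSpace ℝ (Fin p), M.IsOptParam g θs →
      (∀ s, M.valueAt (g.logit θs) s = M.optValue s) ∧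
      ∀ R : ℝ, M.LogDensityBound (g.logit θs) R →
      ∀ θ : EuclideanSpace ℝ (Fin p), M.LogDensityBound (g.logit θ) R →
        DifferentiableAt ℝ (fun ϑ => M.value (g.logit ϑ) ρ) θ ∧
        0 ≤ M.value (g.logit θ) ρ - M.value (g.logit θs) ρ ∧
        (∃ C : ℝ, 0 < C ∧
          (M.plConst g ρ R θs (M.lamFisher g ρ θs θ) ≠ ⊤ →
            C = (M.plConst g ρ R θs (M.lamFisher g ρ θs θ)).toReal) ∧
          M.value (g.logit θ) ρ - M.value (g.logit θs) ρ ≤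
            C * ‖gradient (fun ϑ => M.value (g.logit ϑ) ρ) θ‖ ^ 2) ∧
        (g.IsSimplex → ∃ C : ℝ, 0 < C ∧
          (M.plConst g ρ R θs (M.lamCov g ρ θ) ≠ ⊤ →
            C = (M.plConst g ρ R θs (M.lamCov g ρ θ)).toReal) ∧
          M.value (g.logit θ) ρ - M.value (g.logit θs) ρ ≤
            C * ‖gradient (fun ϑ => M.value (g.logit ϑ) ρ) θ‖ ^ 2) := by
  refine ⟨M.existsUnique_isOptParam hQ, fun θs hθs => ?_⟩
  obtain ⟨hmin, hopt⟩ := M.valueAt_isOptParam hθs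
  refine ⟨hopt, fun R hR θ _ => ?_⟩
  obtain ⟨v, hv, -⟩ := M.exists_hasGradientAt_value g θ ρ
  obtain ⟨s₀⟩ := nonempty_of_isProbabilityMeasure ρ
  obtain ⟨a₀⟩ := nonempty_of_isProbabilityMeasure M.μ
  have hR0 : 0 ≤ R := (abs_nonneg _).trans (hR s₀ a₀)
  have hvar (x : EuclideanSpace ℝ (Fin p)) (s : S) :
      0 ≤ Var[g.logit x s; M.policy (g.logit θ) s] := variance_nonneg _ _
  obtain ⟨δ, hδ⟩ := hQ.exists_isCompatible (θ := θ)
  refine ⟨hv.differentiableAt, ?_, ?_, fun hg => ?_⟩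
  · rw [M.value_eq_integral_valueAt, M.value_eq_integral_valueAt, sub_nonneg]
    exact integral_mono ((M.isBddMeas_valueAt _).integrable ρ)
      ((M.isBddMeas_valueAt _).integrable ρ) (hmin _)
  · refine hδ.exists_plConst ρ θs hR0 fun hD => ?_
    exact (M.integral_mul_le_integral_variance g θ _ δ (M.lambdaMin_fisher_nonneg g θ)
      (M.lambdaMin_fisher_mul_le g θ δ)).trans
      (M.integral_occ_le_densitySup_mul _ _ ρ hD (M.isBddMeas_variance g θ δ) (hvar δ))
  · obtain ⟨δ', hδ', hsum⟩ := hδ.exists_sum_eq_zero hg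
    refine hδ'.exists_plConst ρ θs hR0 fun hD => ?_
    refine (M.integral_mul_le_integral_variance g θ _ δ' (M.lambdaMin_featureCov_nonneg g θ)
      (M.lambdaMin_featureCov_mul_le g θ hg hsum)).trans ?_
    -- Here no change of measure is needed, and the factor `D / (1 - γ)` is at least `1`.
    have h1 : 1 ≤ (densitySup (M.occ (g.logit θs) ρ) ρ).toReal := by
      rw [← ENNReal.toReal_one]
      exact ENNReal.toReal_mono hD one_le_densitySup
    refine le_mul_of_one_le_left (integral_nonneg (hvar δ')) ?_
    rw [one_le_div M.one_sub_gamma_pos]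
    linarith [M.γ_nonneg]
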